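/- **Notation.** Let $\Lambda$ be a lattice and $V=\Lambda\otimes_{\mathbb Z}\mathbb R$. A *tropical $k$-cycle* $X$ in $V$ is a non-empty finite fan of closed rational polyhedral cones in $V$, of pure dimension $k$, with a non-zero rational weight $w_X(\sigma)$ on each $k$-dimensional cone $\sigma$, such that the balancing condition $$\sum_{\sigma>\tau} w_X(\sigma)\,v_{\sigma/\tau}=0 \mod V_\tau$$ holds at every $(k-1)$-dimensional cone $\tau$ of $X$; here the sum runs over the $k$-dimensional cones $\sigma$ of $X$ having $\tau$ as a face, $V_\tau$ is the linear span of $\tau$, and $v_{\sigma/\tau}$ is the primitive lattice normal vector of $\sigma$ relative to $\tau$. Write $|X|$ for the union of the cones of $X$. The cycle $X$ is *(globally) irreducible* if there is no tropical $k$-cycle $Y$ in $V$ with $|Y|\subsetneq|X|$. It is *locally irreducible* if for each $(k-1)$-dimensional cone $\tau$ of $X$ the weights of the $k$-dimensional cones of $X$ adjacent to $\tau$ are, up to a common rational multiple, the only rational weights on these cones satisfying the balancing condition at $\tau$. For $I\subset\{1,\dots,n\}$ with $2\le|I|\le n-2$ let $v_I$ be the class in $\mathbb R^{\binom n2}/\Phi(\mathbb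 R^n)$, $\Phi(a)=(a_i+a_j)_{i<j}$, of the vector whose $\{i,j\}$-coordinate is $1$ if exactly one of $i,j$ lies in $I$ and $0$ otherwise. The fan $\mathcal M_{0,n}$ of rational $n$-marked tropical curves lives in $\mathbb R^{\binom n2}/\Phi(\mathbb R^n)$ with the lattice generated by all $v_I$; its cones are the cones generated by $\{v_I : I\in S\}$, where $S$ is a set of splits $I\,|\,I^c$ cut out by the bounded edges of an $n$-marked tree (equivalently, pairwise compatible splits: $I\subset J$, $J\subset I$, $I\cap J=\emptyset$ or $I\cup J=\{1,\dots,n\}$ for all $I,J\in S$). A *divisor* in $\mathcal M_{0,n}$ is a tropical cycle of dimension $n-4=\dim\mathcal M_{0,n}-1$ in this space all of whose cones are cones of $\mathcal M_{0,n}$. **Proposition.** In $\mathcal M_{0,6}$ every locally irreducible divisor is also globally irreducible. -/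

import Mathlib

/-! ### Rational polyhedral fans and tropical cycles in `V = Λ ⊗ ℝ` -/

section TropicalCycles

variable {V : Type*} [AddCommGroup V] [Module ℝ V]

/-- The linear subspace `V_σ` spanned by a cone `σ`. -/
def coneSpan (σ : PointedCone ℝ V) : Submodule ℝ V :=
  Submodule.span ℝ (σ : Set V)

/-- The dimension of a cone. -/
noncomputable def coneDim (σ : PointedCone ℝ V) : ℕ :=
  Module.finrank ℝ (coneSpan σ)

/-- A rational polyhedral cone: generated by finitely many lattice vectors. -/
def IsRationalCone (Λ : Submodule ℤ V) (σ : PointedCone ℝ V) : Prop :=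
  ∃ S : Finset V, (S : Set V) ⊆ (Λ : Set V) ∧ σ = PointedCone.hull ℝ (S : Set V)

/-- The vector `u` represents the primitive lattice normal vector `v_{σ/τ}`, i.e. its class
modulo `V_τ` generates `Λ_σ / Λ_τ` (where `Λ_σ = Λ ∩ V_σ`, `Λ_τ = Λ ∩ V_τ`) and lies in the image
of the cone `σ`. Such a class is unique for a face `τ` of codimension one of a rational cone. -/
def IsLatticeNormal (Λ : Submodule ℤ V) (σ τ : PointedCone ℝ V) (u : V) : Prop :=
  u ∈ Λ ∧ (∃ x ∈ σ, u - x ∈ coneSpan τ) ∧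
    ∀ y ∈ Λ, y ∈ coneSpan σ → ∃ m : ℤ, y - m • u ∈ coneSpan τ

/-- A (finite, non-empty) rational polyhedral fan of pure dimension `k`. -/
structure PureFan (Λ : Submodule ℤ V) (k : ℕ) where
  /-- the cones of the fan -/
  cones : Finset (PointedCone ℝ V)
  nonempty : cones.Nonempty
  rational : ∀ σ ∈ cones, IsRationalCone Λ σ
  face_mem : ∀ σ ∈ cones, ∀ τ : PointedCone ℝ V, τ.IsFaceOf σ → τ ∈ cones
  inter_face : ∀ σ ∈ cones, ∀ σ' ∈ cones, (σ ⊓ σ').IsFaceOf σ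
  pure : ∀ τ ∈ cones, ∃ σ ∈ cones, τ ≤ σ ∧ coneDim σ = k

namespace PureFan

variable {Λ : Submodule ℤ V} {k : ℕ}

open Classical in
/-- The `k`-dimensional cones `σ > τ` of a pure `k`-dimensional fan. -/
noncomputable def star (X : PureFan Λ k) (τ : PointedCone ℝ V) : Finset (PointedCone ℝ V) :=
  X.cones.filter fun σ => τ.IsFaceOf σ ∧ coneDim σ = k

/-- The support `|X|`, the union of all cones. -/
def support (X : PureFan Λ k) : Set V :=
  ⋃ σ ∈ X.cones, (σ : Set V)

/-- The weights `w` satisfy the balancing condition `∑_{σ > τ} w(σ) v_{σ/τ} = 0 mod V_τ` at `τ`. -/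
def BalancedAt (X : PureFan Λ k) (w : PointedCone ℝ V → ℚ) (τ : PointedCone ℝ V) : Prop :=
  ∃ u : PointedCone ℝ V → V, (∀ σ ∈ X.star τ, IsLatticeNormal Λ σ τ (u σ)) ∧
    ∑ σ ∈ X.star τ, (w σ : ℝ) • u σ ∈ coneSpan τ

end PureFan

/-- A tropical `k`-cycle: a pure `k`-dimensional rational fan with non-zero rational weights on its
`k`-dimensional cones (the values of `weight` elsewhere are irrelevant) that is balanced at all
cones of dimension `k - 1`. -/
structure TropicalCycle (Λ : Submodule ℤ V) (k : ℕ) extends PureFan Λ k where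
  /-- the weight function -/
  weight : PointedCone ℝ V → ℚ
  weight_ne_zero : ∀ σ ∈ cones, coneDim σ = k → weight σ ≠ 0
  balanced : ∀ τ ∈ cones, coneDim τ + 1 = k → toPureFan.BalancedAt weight τ

namespace TropicalCycle

variable {Λ : Submodule ℤ V} {k : ℕ}

/-- Global irreducibility: no tropical cycle of the same dimension has strictly smaller support. -/
def IsIrreducible (X : TropicalCycle Λ k) : Prop :=
  ¬ ∃ Y : TropicalCycle Λ k, Y.support ⊂ X.support

/-- Local irreducibility: at every `(k - 1)`-dimensional cone `τ`, any choice of (rational) weights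
on the adjacent `k`-dimensional cones of `X` that is balanced at `τ` is a multiple of the given
weights of `X`. -/
def IsLocallyIrreducible (X : TropicalCycle Λ k) : Prop :=
  ∀ τ ∈ X.cones, coneDim τ + 1 = k → ∀ a : PointedCone ℝ V → ℚ, X.BalancedAt a τ →
    ∃ c : ℚ, ∀ σ ∈ X.star τ, a σ = c * X.weight σ

end TropicalCycle

end TropicalCycles

/-! ### The fan `M_{0,n}` of rational `n`-marked tropical curves -/

namespace TropicalM0

/-- The pairs `i < j` of markings, indexing the coordinates of `ℝ^(n choose 2)`. -/
abbrev Pairs (n : ℕ) : Type := {p : Fin n × Fin n // p.1 < p.2}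

/-- The map `Φ : ℝⁿ → ℝ^(n choose 2)`, `a ↦ (a_i + a_j)_{i < j}`. -/
def phi (n : ℕ) : (Fin n → ℝ) →ₗ[ℝ] (Pairs n → ℝ) where
  toFun a := fun p => a p.1.1 + a p.1.2
  map_add' a b := by
    funext p
    simp only [Pi.add_apply]
    ring
  map_smul' c a := by
    funext p
    simp only [Pi.smul_apply, smul_eq_mul, RingHom.id_apply]
    ring

/-- The ambient space `ℝ^(n choose 2) / Φ(ℝⁿ)`. -/
abbrev Ambient (n : ℕ) : Type := (Pairs n → ℝ) ⧸ LinearMap.range (phi n)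

/-- The vector `v_I`: the class of the vector of pairwise distances of the markings in the curve
with a single bounded edge, of length one, separating the markings in `I` from the others. -/
noncomputable def splitVector (n : ℕ) (I : Finset (Fin n)) : Ambient n :=
  Submodule.Quotient.mk fun p : Pairs n => if (p.1.1 ∈ I ↔ p.1.2 ∈ I) then (0 : ℝ) else 1

/-- The splits `I | Iᶜ` that are cut out by bounded edges of stable `n`-marked trees. -/
def IsSplit (n : ℕ) (I : Finset (Fin n)) : Prop :=
  2 ≤ I.card ∧ I.card + 2 ≤ n

/-- The splits `I | Iᶜ` and `J | Jᶜ` are compatible, i.e. cut out by bounded edges of a common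
`n`-marked tree. -/
def Compatible {n : ℕ} (I J : Finset (Fin n)) : Prop :=
  I ⊆ J ∨ J ⊆ I ∨ Disjoint I J ∨ I ∪ J = Finset.univ

/-- The lattice generated by the vectors `v_I`. -/
noncomputable def lattice (n : ℕ) : Submodule ℤ (Ambient n) :=
  Submodule.span ℤ {v | ∃ I, IsSplit n I ∧ v = splitVector n I}

/-- The cones of `M_{0,n}`. A combinatorial type of `n`-marked rational tropical curves is given by
the set `S` of pairwise compatible splits cut out by its bounded edges, and the corresponding
(closed) cone is generated by the vectors `v_I` for `I` in `S`: a curve with edge lengths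
`l_I` has the distance vector `∑ l_I v_I`. -/
def cones (n : ℕ) : Set (PointedCone ℝ (Ambient n)) :=
  {σ | ∃ S : Set (Finset (Fin n)), (∀ I ∈ S, IsSplit n I) ∧ (∀ I ∈ S, ∀ J ∈ S, Compatible I J) ∧
    σ = PointedCone.hull ℝ (splitVector n '' S)}

/-- A tropical `k`-cycle in `M_{0,n}` is a divisor if it has codimension one, i.e.
`k + 1 = dim M_{0,n} = n - 3`, and all its cones are cones of `M_{0,n}`. -/
def IsDivisor (n : ℕ) {k : ℕ} (D : TropicalCycle (lattice n) k) : Prop :=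
  k + 4 = n ∧ ∀ σ ∈ D.cones, σ ∈ cones n

end TropicalM0

/-! Suppose a surface `Y` has support strictly inside $|D|$. Two facts about supports reduce the
problem to combinatorics. A subcycle that meets the interior of a two-dimensional cone of `D`
contains that cone (`hull_pair_subset_support`), because by balancing it cannot stop in the
interior. If it contains a ray of `D`, it enters every two-dimensional cone of `D` at this ray
(`exists_mem_of_mem_star`): the cones of `Y` at the ray yield a balanced weighting of the star of
`D`, and by local irreducibility such a weighting is a non-zero multiple of the weights of `D`, so
it vanishes nowhere. Hence no two-dimensional cone of `D` joins a ray inside $|Y|$ to a ray outside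
it.

Each of these two classes of rays gives a graph on the six markings, with an edge $ij$ when the ray
of $v_{ij}$ is in the class. Balancing of `D` restricts both graphs. At $v_{ijk}$ the weights
towards $v_{ij}$, $v_{ik}$, $v_{jk}$ are equal. At $v_{ij}$, with $t_k$ the weight towards
$v_{ijk}$, the weight towards $v_{kl}$ is $s+t_k+t_l$ for a constant $s$. Let $T$ be the set of $k$
with $t_k\ne 0$. Then $k\in T$ forces the edges $ik$ and $jk$. If $s\ne 0$, all pairs outside $T$
are edges; if $s=0$, then $T$ is non-empty and joined to all remaining markings. Graphs with these
properties are called saturated (`IsDivisor.isSaturated`).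

Two saturated graphs on six vertices, each with an edge, share an edge by a finite check
(`IsSaturated.exists_common_edge`). The two graphs here are disjoint, and every two-dimensional cone
of $\mathcal M_{0,6}$ has a ray of the form $v_{ij}$, so one class is empty and $|Y|=|D|$.

The relations are extracted with quartet forms: linear forms attached to four markings that take
only the values $0,\pm2$ on split vectors. -/

section FinitelyGeneratedCones

/-! ### Finitely generated cones are closed -/

theorem PointedCone.mem_hull_finset {V : Type*} [AddCommGroup V] [Module ℝ V] {S : Finset V}
    {x : V} :
    x ∈ PointedCone.hull ℝ (S : Set V) ↔
      ∃ c : V → ℝ, (∀ s ∈ S, 0 ≤ c s) ∧ ∑ s ∈ S, c s • s = x := by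
  constructor
  · intro h
    obtain ⟨f, -, hf⟩ := Submodule.mem_span_finset.1 h
    exact ⟨fun s => (f s : ℝ), fun s _ => (f s).2, hf⟩
  · rintro ⟨c, hc, rfl⟩
    exact Submodule.sum_mem _ fun s hs =>
      PointedCone.smul_mem _ (hc s hs) (PointedCone.subset_hull hs)

theorem PointedCone.mem_hull_pair {V : Type*} [AddCommGroup V] [Module ℝ V] {p q x : V} :
    x ∈ PointedCone.hull ℝ ({p, q} : Set V) ↔
      ∃ a b : ℝ, 0 ≤ a ∧ 0 ≤ b ∧ x = a • p + b • q := by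
  constructor
  · intro h
    obtain ⟨a, b, hab⟩ := Submodule.mem_span_pair.1 h
    exact ⟨a, b, a.2, b.2, hab.symm⟩
  · rintro ⟨a, b, ha, hb, rfl⟩
    exact add_mem (PointedCone.smul_mem _ ha (PointedCone.subset_hull (by simp)))
      (PointedCone.smul_mem _ hb (PointedCone.subset_hull (by simp)))

theorem PointedCone.mem_hull_singleton {V : Type*} [AddCommGroup V] [Module ℝ V] {p x : V} :
    x ∈ PointedCone.hull ℝ ({p} : Set V) ↔ ∃ a : ℝ, 0 ≤ a ∧ x = a • p := by
  constructor
  · intro h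
    obtain ⟨a, ha⟩ := Submodule.mem_span_singleton.1 h
    exact ⟨a, a.2, ha.symm⟩
  · rintro ⟨a, ha, rfl⟩
    exact PointedCone.smul_mem _ ha (PointedCone.subset_hull (by simp))

/-- Carathéodory's reduction step: a generator can be dropped from any combination of linearly
dependent generators. -/
theorem PointedCone.exists_mem_hull_erase {V : Type*} [AddCommGroup V] [Module ℝ V] [DecidableEq V]
    {S : Finset V} {g : V → ℝ} (hg : ∑ s ∈ S, g s • s = 0) {s₀ : V} (hs₀ : s₀ ∈ S)
    (hpos : 0 < g s₀) {x : V} (hx : x ∈ PointedCone.hull ℝ (S : Set V)) :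
    ∃ s ∈ S, x ∈ PointedCone.hull ℝ ((S.erase s : Finset V) : Set V) := by
  obtain ⟨c, hc, rfl⟩ := PointedCone.mem_hull_finset.1 hx
  -- Minimality of `c s / g s` among the positive `g` makes `c - (c s / g s) g` non-negative, with
  -- coefficient zero at `s`.
  obtain ⟨s, hs, hmin⟩ := (S.filter fun s => 0 < g s).exists_min_image (fun s => c s / g s)
    ⟨s₀, by simp [hs₀, hpos]⟩
  obtain ⟨hsS, hgs⟩ := Finset.mem_filter.1 hs
  refine ⟨s, hsS, PointedCone.mem_hull_finset.2 ⟨fun r => c r - c s / g s * g r, ?_, ?_⟩⟩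
  · intro r hr
    have hrS := Finset.mem_of_mem_erase hr
    have h0 : 0 ≤ c s / g s := div_nonneg (hc s hsS) hgs.le
    rcases le_or_gt (g r) 0 with h | h
    · nlinarith [hc r hrS, mul_nonneg h0 (neg_nonneg.2 h)]
    · have := hmin r (by simp [hrS, h])
      rw [le_div_iff₀ h] at this
      linarith
  · have h1 : ∑ r ∈ S, (c r - c s / g s * g r) • r = ∑ r ∈ S, c r • r := by
      simp only [sub_smul, mul_smul, Finset.sum_sub_distrib, ← Finset.smul_sum, hg, smul_zero,
        sub_zero]
    rw [← h1, ← Finset.add_sum_erase S _ hsS]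
    simp [div_mul_cancel₀ _ hgs.ne']

/-- Independent generators present the cone as the image of the closed orthant under a closed
embedding. For dependent ones, Carathéodory's step writes it as a finite union of cones with fewer
generators. -/
theorem PointedCone.isClosed_hull_finset {E : Type*} [NormedAddCommGroup E] [NormedSpace ℝ E]
    [FiniteDimensional ℝ E] (S : Finset E) :
    IsClosed (PointedCone.hull ℝ (S : Set E) : Set E) := by
  classical
  induction S using Finset.strongInduction with
  | H S ih =>
  by_cases hli : LinearIndepOn ℝ id (S : Set E)
  · let Φ : (S → ℝ) →ₗ[ℝ] E := Fintype.linearCombination ℝ (fun s : S => (s : E))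
    have hΦ : ∀ c, Φ c = ∑ s : S, c s • (s : E) := fun c => Fintype.linearCombination_apply ..
    have hinj : LinearMap.ker Φ = ⊥ := by
      refine LinearMap.ker_eq_bot.2 ?_
      exact LinearIndependent.fintypeLinearCombination_injective hli
    have himg : (PointedCone.hull ℝ (S : Set E) : Set E) = Φ '' Set.Ici 0 := by
      ext x
      constructor
      · intro hx
        obtain ⟨c, hc, rfl⟩ := PointedCone.mem_hull_finset.1 hx
        refine ⟨fun s => c s, fun s => hc s s.2, ?_⟩
        rw [hΦ, ← Finset.sum_coe_sort S fun s => c s • s]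
      · rintro ⟨c, hc, rfl⟩
        rw [hΦ]
        exact Submodule.sum_mem _ fun s _ =>
          PointedCone.smul_mem _ (hc s) (PointedCone.subset_hull s.2)
    rw [himg]
    exact (LinearMap.isClosedEmbedding_of_injective hinj).isClosedMap _ isClosed_Ici
  · have hdep : ∃ g : E → ℝ, ∑ s ∈ S, g s • s = 0 ∧ ∃ s ∈ S, 0 < g s := by
      rw [linearIndepOn_finset_iff] at hli
      push Not at hli
      obtain ⟨g, hg, s, hs, hne⟩ := hli
      simp only [id] at hg
      rcases lt_or_gt_of_ne hne with h | h
      · exact ⟨fun s => -g s, by simp [hg], s, hs, by simpa using h⟩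
      · exact ⟨g, hg, s, hs, h⟩
    obtain ⟨g, hg, s₀, hs₀, hpos⟩ := hdep
    have hU : (PointedCone.hull ℝ (S : Set E) : Set E) =
        ⋃ s ∈ S, (PointedCone.hull ℝ ((S.erase s : Finset E) : Set E) : Set E) := by
      ext x
      simp only [Set.mem_iUnion, SetLike.mem_coe, exists_prop]
      constructor
      · exact PointedCone.exists_mem_hull_erase hg hs₀ hpos
      · rintro ⟨s, -, hx⟩
        exact Submodule.span_mono (by exact_mod_cast Finset.erase_subset s S) hx
    rw [hU]
    exact isClosed_biUnion_finset fun s hs => ih _ (Finset.erase_ssubset hs)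

/-- `V` carries no topology, so closedness is only recorded along lines, after transport to
coordinates. -/
theorem IsRationalCone.isClosed_line {V : Type*} [AddCommGroup V] [Module ℝ V]
    [FiniteDimensional ℝ V] {Λ : Submodule ℤ V} {σ : PointedCone ℝ V} (hσ : IsRationalCone Λ σ)
    (x y : V) : IsClosed {t : ℝ | x + t • y ∈ σ} := by
  classical
  obtain ⟨S, -, rfl⟩ := hσ
  let e : V ≃ₗ[ℝ] (Fin (Module.finrank ℝ V) → ℝ) := LinearEquiv.ofFinrankEq _ _ (by simp)
  have h : {t : ℝ | x + t • y ∈ PointedCone.hull ℝ (S : Set V)} =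
      (fun t : ℝ => e x + t • e y) ⁻¹'
        (PointedCone.hull ℝ ((S.image e : Finset _) : Set (Fin (Module.finrank ℝ V) → ℝ))) := by
    ext t
    simp only [Set.mem_ofPred_eq, Set.mem_preimage, SetLike.mem_coe, PointedCone.mem_hull_finset]
    rw [← map_smul, ← map_add]
    constructor
    · rintro ⟨c, hc, h⟩
      refine ⟨fun z => c (e.symm z), ?_, ?_⟩
      · intro z hz
        obtain ⟨s, hs, rfl⟩ := Finset.mem_image.1 hz
        simpa using hc s hs
      · rw [Finset.sum_image (fun _ _ _ _ h => e.injective h), ← h, map_sum]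
        simp
    · rintro ⟨c, hc, h⟩
      refine ⟨fun z => c (e z), fun s hs => hc _ (Finset.mem_image_of_mem _ hs), ?_⟩
      apply e.injective
      rw [Finset.sum_image (fun _ _ _ _ h => e.injective h)] at h
      rw [← h, map_sum]
      simp
  rw [h]
  exact (PointedCone.isClosed_hull_finset _).preimage (by fun_prop)

end FinitelyGeneratedCones

/-! ### Two-dimensional cones of a fan around a common ray -/

section PlanarCones

open Filter Topology

variable {V : Type*} [AddCommGroup V] [Module ℝ V]

theorem mem_coneSpan {σ : PointedCone ℝ V} {x : V} (hx : x ∈ σ) : x ∈ coneSpan σ :=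
  Submodule.subset_span hx

theorem coneSpan_le {σ : PointedCone ℝ V} {W : Submodule ℝ V} (h : ∀ x ∈ σ, x ∈ W) :
    coneSpan σ ≤ W :=
  Submodule.span_le.2 h

theorem coneSpan_mono {σ τ : PointedCone ℝ V} (h : σ ≤ τ) : coneSpan σ ≤ coneSpan τ :=
  Submodule.span_mono h

theorem coneSpan_hull (s : Set V) : coneSpan (PointedCone.hull ℝ s) = Submodule.span ℝ s :=
  le_antisymm (coneSpan_le fun _ hx => PointedCone.hull_le_span ℝ s hx)
    (Submodule.span_mono PointedCone.subset_hull)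

theorem notMem_span_singleton_comm {x z : V} (hx : x ≠ 0)
    (hz : z ∉ Submodule.span ℝ ({x} : Set V)) : x ∉ Submodule.span ℝ ({z} : Set V) := by
  intro h
  obtain ⟨a, rfl⟩ := Submodule.mem_span_singleton.1 h
  have ha : a ≠ 0 := by
    rintro rfl
    simp at hx
  exact hz (Submodule.mem_span_singleton.2 ⟨a⁻¹, by rw [smul_smul, inv_mul_cancel₀ ha, one_smul]⟩)

theorem ne_zero_of_notMem_span {x z : V} (hz : z ∉ Submodule.span ℝ ({x} : Set V)) : z ≠ 0 := by
  rintro rfl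
  exact hz (zero_mem _)

theorem linearIndependent_pair_of_notMem_span {x z : V} (hx : x ≠ 0)
    (hz : z ∉ Submodule.span ℝ ({x} : Set V)) : LinearIndependent ℝ ![x, z] :=
  (LinearIndependent.pair_iff' hx).2 fun a ha =>
    hz (Submodule.mem_span_singleton.2 ⟨a, ha⟩)

theorem finrank_span_pair {x z : V} (hx : x ≠ 0)
    (hz : z ∉ Submodule.span ℝ ({x} : Set V)) :
    Module.finrank ℝ (Submodule.span ℝ ({x, z} : Set V)) = 2 := by
  have h := finrank_span_eq_card (linearIndependent_pair_of_notMem_span hx hz)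
  rwa [Matrix.range_cons_cons_empty, Fintype.card_fin] at h

theorem smul_add_smul_notMem_span {x z : V} (hz : z ∉ Submodule.span ℝ ({x} : Set V)) (a : ℝ)
    {b : ℝ} (hb : b ≠ 0) : a • x + b • z ∉ Submodule.span ℝ ({x} : Set V) := by
  intro h
  have hax : a • x ∈ Submodule.span ℝ ({x} : Set V) :=
    Submodule.smul_mem _ _ (Submodule.mem_span_singleton_self x)
  have h2 := (Submodule.add_mem_iff_right _ hax).1 h
  exact hz ((Submodule.smul_mem_iff _ hb).1 h2)

/-- A linear form that vanishes on `x` and takes the value one on `z`. -/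
theorem exists_form_of_notMem_span {x z : V} (hz : z ∉ Submodule.span ℝ ({x} : Set V)) :
    ∃ f : V →ₗ[ℝ] ℝ, f x = 0 ∧ f z = 1 := by
  obtain ⟨f, hfz, hf⟩ := Submodule.exists_le_ker_of_notMem hz
  refine ⟨(f z)⁻¹ • f, ?_, by simp [hfz]⟩
  have : f x = 0 := hf (Submodule.mem_span_singleton_self x)
  simp [this]

theorem eq_of_smul_add_smul_eq {x z : V} (hx : x ≠ 0)
    (hz : z ∉ Submodule.span ℝ ({x} : Set V)) {a b c d : ℝ}
    (h : a • x + b • z = c • x + d • z) : a = c ∧ b = d := by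
  have h' : (a - c) • x + (b - d) • z = 0 := by
    rw [sub_smul, sub_smul, sub_add_sub_comm, h, sub_self]
  have := LinearIndependent.pair_iff.1 (linearIndependent_pair_of_notMem_span hx hz) _ _ h'
  exact ⟨sub_eq_zero.1 this.1, sub_eq_zero.1 this.2⟩

theorem PointedCone.isFaceOf_inf_ker (C : PointedCone ℝ V) (f : V →ₗ[ℝ] ℝ)
    (hf : ∀ y ∈ C, 0 ≤ f y) :
    (C ⊓ PointedCone.ofSubmodule (LinearMap.ker f)).IsFaceOf C := by
  refine ⟨inf_le_left, fun {x y a} hx hy ha h => ⟨hx, ?_⟩⟩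
  have h0 : f (a • x + y) = 0 := h.2
  rw [map_add, map_smul, smul_eq_mul] at h0
  have h1 := hf x hx
  have h2 := hf y hy
  change f x = 0
  nlinarith

theorem PointedCone.isFaceOf_hull_pair {p q : V} (hp : p ≠ 0)
    (hq : q ∉ Submodule.span ℝ ({p} : Set V)) :
    (PointedCone.hull ℝ ({p} : Set V)).IsFaceOf (PointedCone.hull ℝ ({p, q} : Set V)) := by
  refine ⟨Submodule.span_mono (by simp), fun {x y a} hx hy ha h => ?_⟩
  obtain ⟨b, c, hb, hc, rfl⟩ := PointedCone.mem_hull_pair.1 hx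
  obtain ⟨b', c', hb', hc', rfl⟩ := PointedCone.mem_hull_pair.1 hy
  obtain ⟨e, -, he⟩ := PointedCone.mem_hull_singleton.1 h
  have h2 : (a * b + b') • p + (a * c + c') • q = e • p + (0 : ℝ) • q := by
    rw [zero_smul, add_zero, ← he]
    module
  have h3 := (eq_of_smul_add_smul_eq hp hq h2).2
  have hc0 : c = 0 := by nlinarith [mul_nonneg ha.le hc]
  exact PointedCone.mem_hull_singleton.2 ⟨b, hb, by simp [hc0]⟩

theorem coneDim_eq_one_of_coneSpan {F : PointedCone ℝ V} {x : V} (hx : x ≠ 0)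
    (hF : coneSpan F = Submodule.span ℝ {x}) : coneDim F = 1 := by
  rw [coneDim, hF, finrank_span_singleton hx]

theorem exists_mem_notMem_span {C : PointedCone ℝ V} (hC : coneDim C = 2) (x : V) :
    ∃ z ∈ C, z ∉ Submodule.span ℝ ({x} : Set V) := by
  by_contra! h
  have h1 := Submodule.finrank_mono (coneSpan_le h)
  have h2 := finrank_span_le_card (R := ℝ) ({x} : Set V)
  rw [coneDim] at hC
  simp at h2
  omega

variable {Λ : Submodule ℤ V} {k : ℕ}

namespace PureFan

theorem mem_support {X : PureFan Λ k} {x : V} : x ∈ X.support ↔ ∃ σ ∈ X.cones, x ∈ σ := by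
  simp [PureFan.support]

theorem mem_star {X : PureFan Λ k} {σ τ : PointedCone ℝ V} :
    σ ∈ X.star τ ↔ σ ∈ X.cones ∧ τ.IsFaceOf σ ∧ coneDim σ = k := by
  classical
  simp [PureFan.star]

theorem exists_maximal_cone {X : PureFan Λ k} {x : V} (hx : x ∈ X.support) :
    ∃ σ ∈ X.cones, x ∈ σ ∧ coneDim σ = k := by
  obtain ⟨τ, hτ, hxτ⟩ := mem_support.1 hx
  obtain ⟨σ, hσ, hle, hdim⟩ := X.pure τ hτ
  exact ⟨σ, hσ, hle hxτ, hdim⟩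

theorem smul_mem_support {X : PureFan Λ k} {x : V} (hx : x ∈ X.support) {a : ℝ} (ha : 0 ≤ a) :
    a • x ∈ X.support := by
  obtain ⟨σ, hσ, h⟩ := mem_support.1 hx
  exact mem_support.2 ⟨σ, hσ, PointedCone.smul_mem _ ha h⟩

/-- A ray of a fan is a face of each cone that contains a generator of it. -/
theorem isFaceOf_of_mem (X : PureFan Λ k) {F C : PointedCone ℝ V} (hF : F ∈ X.cones)
    (hC : C ∈ X.cones) {x : V} (hxF : x ∈ F) (hxC : x ∈ C)
    (hspan : coneSpan F ≤ Submodule.span ℝ {x}) : F.IsFaceOf C := by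
  have h1 := X.inter_face F hF C hC
  have h2 := X.inter_face C hC F hF
  have hle : F ≤ C := by
    intro y hy
    obtain ⟨c, rfl⟩ := Submodule.mem_span_singleton.1 (hspan (mem_coneSpan hy))
    rcases le_or_gt 0 c with hc | hc
    · exact PointedCone.smul_mem _ hc hxC
    -- Cones need not be pointed, so `F` may be a whole line. The sum of two opposite points is
    -- zero, which lies in the face `F ⊓ C`, hence so do the points.
    · have hy' : (-c) • x ∈ F := PointedCone.smul_mem _ (by linarith) hxF
      have hsum : c • x + (-c) • x ∈ F ⊓ C := by
        rw [← add_smul, add_neg_cancel, zero_smul]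
        exact zero_mem _
      exact (h1.mem_of_add_mem_left hy hy' hsum).2
  rwa [inf_eq_right.2 hle] at h2

end PureFan

variable [FiniteDimensional ℝ V]

theorem coneSpan_eq_span_pair {C : PointedCone ℝ V} (hC : coneDim C = 2) {x z : V} (hx : x ∈ C)
    (hz : z ∈ C) (hx0 : x ≠ 0) (hzx : z ∉ Submodule.span ℝ ({x} : Set V)) :
    coneSpan C = Submodule.span ℝ {x, z} := by
  symm
  refine Submodule.eq_of_le_of_finrank_eq (Submodule.span_le.2 ?_) ?_
  · rintro y (rfl | rfl)
    exacts [mem_coneSpan hx, mem_coneSpan hz]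
  · rw [finrank_span_pair hx0 hzx]
    exact hC.symm

namespace PureFan

theorem coneDim_le (X : PureFan Λ k) {σ : PointedCone ℝ V} (hσ : σ ∈ X.cones) :
    coneDim σ ≤ k := by
  obtain ⟨ρ, -, hle, hρ⟩ := X.pure σ hσ
  rw [← hρ]
  exact Submodule.finrank_mono (coneSpan_mono hle)

theorem isClosed_line (X : PureFan Λ k) (x y : V) : IsClosed {t : ℝ | x + t • y ∈ X.support} := by
  have h : {t : ℝ | x + t • y ∈ X.support} = ⋃ σ ∈ X.cones, {t : ℝ | x + t • y ∈ σ} := by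
    ext t
    simp [PureFan.support]
  rw [h]
  exact isClosed_biUnion_finset fun σ hσ => (X.rational σ hσ).isClosed_line x y

/-- A segment in the support starts inside one of the cones. -/
theorem exists_cone_of_segment (X : PureFan Λ k) {x y : V}
    (h : ∀ t : ℝ, 0 < t → t ≤ 1 → x + t • y ∈ X.support) :
    ∃ ρ ∈ X.cones, x ∈ ρ ∧ ∃ t : ℝ, 0 < t ∧ t ≤ 1 ∧ x + t • y ∈ ρ := by
  have hev : ∀ᶠ t : ℝ in 𝓝[>] 0, 0 < t ∧ t ≤ 1 :=
    Ioc_mem_nhdsGT zero_lt_one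
  have hfreq : ∃ ρ ∈ X.cones, ∃ᶠ t : ℝ in 𝓝[>] 0, x + t • y ∈ ρ := by
    by_contra! hcon
    have hall : ∀ᶠ t : ℝ in 𝓝[>] 0, ∀ ρ ∈ X.cones, x + t • y ∉ ρ :=
      (eventually_all_finset _).2 fun ρ hρ => hcon ρ hρ
    obtain ⟨t, ht, h0, h1⟩ := (hall.and hev).exists
    obtain ⟨ρ, hρ, hmem⟩ := mem_support.1 (h t h0 h1)
    exact ht ρ hρ hmem
  obtain ⟨ρ, hρ, hfr⟩ := hfreq
  refine ⟨ρ, hρ, ?_, ?_⟩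
  · have h0 : (0 : ℝ) ∈ {t : ℝ | x + t • y ∈ ρ} :=
      ((X.rational ρ hρ).isClosed_line x y).mem_of_frequently_of_tendsto hfr
        (tendsto_id.mono_left nhdsWithin_le_nhds)
    simpa using h0
  · obtain ⟨t, ht, h0, h1⟩ := (hfr.and_eventually hev).exists
    exact ⟨t, h0, h1, ht⟩

/-- The face `C ⊓ C'` contains `x` and a point strictly on the side of `z`. Any `y ∈ C` can be
completed by some `w ∈ C` to a non-negative combination of these two, and a face contains the
summands of its points. -/
theorem le_of_same_side (X : PureFan Λ k) {C C' : PointedCone ℝ V} (hC : C ∈ X.cones)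
    (hC' : C' ∈ X.cones) (hdim : coneDim C = 2) {x z : V} (hx : x ≠ 0) (hxC : x ∈ C)
    (hxC' : x ∈ C') (hzC : z ∈ C) (hz : z ∉ Submodule.span ℝ ({x} : Set V)) {α β : ℝ}
    (hβ : 0 < β) (hzC' : α • x + β • z ∈ C') : C ≤ C' := by
  have hface := X.inter_face C hC C' hC'
  have hxG : x ∈ C ⊓ C' := ⟨hxC, hxC'⟩
  have hgG : (α + |α|) • x + β • z ∈ C ⊓ C' := by
    refine ⟨add_mem (PointedCone.smul_mem _ (by linarith [neg_abs_le α]) hxC)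
      (PointedCone.smul_mem _ hβ.le hzC), ?_⟩
    have : (α + |α|) • x + β • z = (α • x + β • z) + |α| • x := by module
    rw [this]
    exact add_mem hzC' (PointedCone.smul_mem _ (abs_nonneg α) hxC')
  intro y hy
  have hys := mem_coneSpan hy
  rw [coneSpan_eq_span_pair hdim hxC hzC hx hz] at hys
  obtain ⟨γ, δ, rfl⟩ := Submodule.mem_span_pair.1 hys
  -- With `N * β = |δ|`, the sum `y + w` becomes `|γ| • x + N • ((α + |α|) • x + β • z)`.
  set N := |δ| / β with hN
  have hN0 : 0 ≤ N := by positivity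
  have hNβ : N * β = |δ| := div_mul_cancel₀ _ hβ.ne'
  have hb : 0 ≤ |γ| - γ + N * (α + |α|) :=
    add_nonneg (sub_nonneg.2 (le_abs_self γ)) (mul_nonneg hN0 (by linarith [neg_abs_le α]))
  have hw : (|γ| - γ + N * (α + |α|)) • x + (|δ| - δ) • z ∈ C :=
    add_mem (PointedCone.smul_mem _ hb hxC)
      (PointedCone.smul_mem _ (sub_nonneg.2 (le_abs_self δ)) hzC)
  have hsum : (γ • x + δ • z) + ((|γ| - γ + N * (α + |α|)) • x + (|δ| - δ) • z) ∈ C ⊓ C' := by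
    have : (γ • x + δ • z) + ((|γ| - γ + N * (α + |α|)) • x + (|δ| - δ) • z) =
        |γ| • x + N • ((α + |α|) • x + β • z) := by
      rw [← hNβ]
      module
    rw [this]
    exact add_mem (PointedCone.smul_mem _ (abs_nonneg γ) hxG) (PointedCone.smul_mem _ hN0 hgG)
  exact (hface.mem_of_add_mem_left hy hw hsum).2

/-- In a fan, two-dimensional cones on the same side of a common ray coincide. -/
theorem eq_of_same_side (X : PureFan Λ k) {C C' : PointedCone ℝ V} (hC : C ∈ X.cones)
    (hC' : C' ∈ X.cones) (hdim : coneDim C = 2) (hdim' : coneDim C' = 2) {x z : V} (hx : x ≠ 0)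
    (hxC : x ∈ C) (hxC' : x ∈ C') (hzC : z ∈ C) (hz : z ∉ Submodule.span ℝ ({x} : Set V))
    {α β : ℝ} (hβ : 0 < β) (hzC' : α • x + β • z ∈ C') : C = C' := by
  refine le_antisymm (X.le_of_same_side hC hC' hdim hx hxC hxC' hzC hz hβ hzC') ?_
  refine X.le_of_same_side (α := -(α / β)) (β := β⁻¹) hC' hC hdim' hx hxC' hxC hzC'
    (smul_add_smul_notMem_span hz α hβ.ne') (inv_pos.2 hβ) ?_
  have : (-(α / β)) • x + β⁻¹ • (α • x + β • z) = z := by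
    rw [smul_add, smul_smul, smul_smul, inv_mul_cancel₀ hβ.ne', one_smul, ← add_assoc, ← add_smul]
    have : -(α / β) + β⁻¹ * α = 0 := by ring
    rw [this, zero_smul, zero_add]
  rwa [this]

/-- A point of a two-dimensional cone lies in the interior or spans a face. -/
theorem exists_opposite_or_face (X : PureFan Λ k) {C : PointedCone ℝ V} (hC : C ∈ X.cones)
    (hdim : coneDim C = 2) {x z : V} (hx : x ≠ 0) (hxC : x ∈ C) (hzC : z ∈ C)
    (hz : z ∉ Submodule.span ℝ ({x} : Set V)) :
    (∃ α β : ℝ, β < 0 ∧ α • x + β • z ∈ C) ∨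
      ∃ F ∈ X.cones, x ∈ F ∧ F.IsFaceOf C ∧ coneSpan F = Submodule.span ℝ {x} := by
  obtain ⟨f, hfx, hfz⟩ := exists_form_of_notMem_span hz
  have hspan := coneSpan_eq_span_pair hdim hxC hzC hx hz
  -- The sign of `f` tells the two sides of the line through `x` apart. If `C` stays on one side,
  -- `ker f` cuts out the face; otherwise `C` has a point on the other side.
  by_cases h : ∀ y ∈ C, 0 ≤ f y
  · right
    have hface := PointedCone.isFaceOf_inf_ker C f h
    refine ⟨_, X.face_mem C hC _ hface, ⟨hxC, hfx⟩, hface, le_antisymm (coneSpan_le ?_) ?_⟩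
    · rintro y ⟨hyC, hy0⟩
      have hys := mem_coneSpan hyC
      rw [hspan] at hys
      obtain ⟨γ, δ, rfl⟩ := Submodule.mem_span_pair.1 hys
      have hδ : f (γ • x + δ • z) = 0 := hy0
      have : δ = 0 := by simpa [hfx, hfz] using hδ
      rw [this, zero_smul, add_zero]
      exact Submodule.smul_mem _ _ (Submodule.mem_span_singleton_self x)
    · refine Submodule.span_le.2 ?_
      rintro y rfl
      exact mem_coneSpan ⟨hxC, hfx⟩
  · left
    push Not at h
    obtain ⟨y, hyC, hy⟩ := h
    have hys := mem_coneSpan hyC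
    rw [hspan] at hys
    obtain ⟨γ, δ, rfl⟩ := Submodule.mem_span_pair.1 hys
    refine ⟨γ, δ, ?_, hyC⟩
    simpa [hfx, hfz] using hy

end PureFan

/-- Every generator of `σ` is a multiple of `u` modulo `V_τ`, so `u ∈ V_τ` would give `V_σ ≤ V_τ`.
-/
theorem IsRationalCone.notMem_of_isLatticeNormal {σ τ : PointedCone ℝ V} {u : V}
    (hσ : IsRationalCone Λ σ) (hu : IsLatticeNormal Λ σ τ u) (hdim : coneDim τ < coneDim σ) :
    u ∉ coneSpan τ := by
  intro h
  obtain ⟨S, hS, rfl⟩ := hσ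
  have hle : coneSpan (PointedCone.hull ℝ (S : Set V)) ≤ coneSpan τ := by
    rw [coneSpan_hull]
    refine Submodule.span_le.2 fun s hs => ?_
    obtain ⟨m, hm⟩ := hu.2.2 s (hS hs) (mem_coneSpan (PointedCone.subset_hull hs))
    have : s = (s - m • u) + m • u := by abel
    rw [this]
    exact add_mem hm (zsmul_mem h m)
  exact absurd (Submodule.finrank_mono hle) (not_le.2 hdim)

/-- If all cones through `x` lie in one plane and on one side of `x`, then `x` spans a face whose
star is the single cone `C`, and one non-zero multiple of a normal vector cannot balance. -/
theorem TropicalCycle.exists_opposite_side (Y : TropicalCycle Λ 2) {C : PointedCone ℝ V}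
    (hC : C ∈ Y.cones) (hdim : coneDim C = 2) {x z : V} (hx : x ≠ 0) (hxC : x ∈ C) (hzC : z ∈ C)
    (hz : z ∉ Submodule.span ℝ ({x} : Set V))
    (hplane : ∀ C' ∈ Y.cones, x ∈ C' → ∀ y ∈ C', y ∈ Submodule.span ℝ ({x, z} : Set V)) :
    ∃ C' ∈ Y.cones, x ∈ C' ∧ ∃ α β : ℝ, β < 0 ∧ α • x + β • z ∈ C' := by
  rcases Y.exists_opposite_or_face hC hdim hx hxC hzC hz with ⟨α, β, hβ, h⟩ |
    ⟨F, hF, hxF, hFC, hFspan⟩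
  · exact ⟨C, hC, hxC, α, β, hβ, h⟩
  by_contra hcon
  push Not at hcon
  have hF1 := coneDim_eq_one_of_coneSpan hx hFspan
  obtain ⟨u, hu, hsum⟩ := Y.balanced F hF (by rw [hF1])
  have hCs : C ∈ Y.star F := PureFan.mem_star.2 ⟨hC, hFC, hdim⟩
  have hstar : Y.star F = {C} := by
    refine Finset.eq_singleton_iff_unique_mem.2 ⟨hCs, fun C' hC' => ?_⟩
    obtain ⟨hC'Y, hFC', hdim'⟩ := PureFan.mem_star.1 hC'
    have hxC' := hFC'.le hxF
    obtain ⟨z', hz'C, hz'⟩ := exists_mem_notMem_span hdim' x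
    obtain ⟨α, β, rfl⟩ := Submodule.mem_span_pair.1 (hplane C' hC'Y hxC' z' hz'C)
    have hβ : 0 < β := by
      refine lt_of_le_of_ne (not_lt.1 fun h => hcon C' hC'Y hxC' α β h hz'C) ?_
      rintro rfl
      exact hz' (by simpa using Submodule.smul_mem _ α (Submodule.mem_span_singleton_self x))
    exact (Y.eq_of_same_side hC hC'Y hdim hdim' hx hxC hxC' hzC hz hβ hz'C).symm
  rw [hstar, Finset.sum_singleton] at hsum
  have hw : ((Y.weight C : ℚ) : ℝ) ≠ 0 := by exact_mod_cast Y.weight_ne_zero C hC hdim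
  exact (Y.rational C hC).notMem_of_isLatticeNormal (hu C hCs) (by omega)
    ((Submodule.smul_mem_iff _ hw).1 hsum)

end PlanarCones

/-! ### Subcycles of a locally irreducible surface -/

section SubcyclesOfSurfaces

open Filter Topology

variable {V : Type*} [AddCommGroup V] [Module ℝ V]

theorem coneDim_hull_pair {p q : V} (hp : p ≠ 0) (hq : q ∉ Submodule.span ℝ ({p} : Set V)) :
    coneDim (PointedCone.hull ℝ ({p, q} : Set V)) = 2 := by
  rw [coneDim, coneSpan_hull, finrank_span_pair hp hq]

/-- A point beyond the face could be added to a positive multiple of `y` to land in `F`, forcing `y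
∈ F`. -/
theorem PointedCone.IsFaceOf.nonneg_of_mem {F C : PointedCone ℝ V} (hF : F.IsFaceOf C) {p y : V}
    (hp : p ∈ F) (hspan : coneSpan F = Submodule.span ℝ {p}) (hy : y ∈ C)
    (hyp : y ∉ Submodule.span ℝ ({p} : Set V)) {α β : ℝ} (h : α • p + β • y ∈ C) : 0 ≤ β := by
  by_contra! hβ
  have h1 : (α • p + β • y) + (|α| - α) • p ∈ C :=
    add_mem h (PointedCone.smul_mem _ (sub_nonneg.2 (le_abs_self α)) (hF.le hp))
  have h2 : (-β) • y + ((α • p + β • y) + (|α| - α) • p) ∈ F := by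
    have : (-β) • y + ((α • p + β • y) + (|α| - α) • p) = |α| • p := by module
    rw [this]
    exact PointedCone.smul_mem _ (abs_nonneg α) hp
  exact hyp (hspan ▸ mem_coneSpan (hF.mem_of_smul_add_mem hy h1 (neg_pos.2 hβ) h2))

variable {Λ : Submodule ℤ V} {D Y : TropicalCycle Λ 2}

/-- At a locally irreducible ray, a balanced set of adjacent cones is the whole star. -/
theorem TropicalCycle.IsLocallyIrreducible.exists_eq_of_balanced (hloc : D.IsLocallyIrreducible)
    {τ : PointedCone ℝ V} (hτ : τ ∈ D.cones) (hdim : coneDim τ = 1) {ι : Type*} [Nonempty ι]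
    (s : Finset ι) (hs : s.Nonempty) (r : ι → PointedCone ℝ V) (hr : ∀ i ∈ s, r i ∈ D.star τ)
    (hinj : Set.InjOn r s) (w : ι → ℚ) (hw : ∀ i ∈ s, w i ≠ 0) (u : ι → V)
    (hu : ∀ i ∈ s, IsLatticeNormal Λ (r i) τ (u i))
    (hsum : ∑ i ∈ s, (w i : ℝ) • u i ∈ coneSpan τ) {ρ : PointedCone ℝ V} (hρ : ρ ∈ D.star τ) :
    ∃ i ∈ s, r i = ρ := by
  classical
  obtain ⟨u₀, hu₀, -⟩ := D.balanced τ hτ (by rw [hdim])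
  let g := Function.invFunOn r (s : Set ι)
  have hg : ∀ i ∈ s, g (r i) = i := fun i hi => hinj.leftInvOn_invFunOn hi
  -- The given weights are extended by zero to the star. The result is a multiple of the weights of
  -- `D`; the factor is non-zero, so no cone of the star is missed.
  let a : PointedCone ℝ V → ℚ := fun ρ => if ρ ∈ s.image r then w (g ρ) else 0
  have ha : ∀ i ∈ s, a (r i) = w i := fun i hi => by
    simp only [a, if_pos (Finset.mem_image_of_mem r hi), hg i hi]
  have hbal : D.BalancedAt a τ := by
    refine ⟨fun ρ => if ρ ∈ s.image r then u (g ρ) else u₀ ρ, fun ρ hρ => ?_, ?_⟩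
    · by_cases h : ρ ∈ s.image r
      · simp only [if_pos h]
        obtain ⟨i, hi, rfl⟩ := Finset.mem_image.1 h
        rw [hg i hi]
        exact hu i hi
      · simp only [if_neg h]
        exact hu₀ ρ hρ
    · rw [← Finset.sum_subset (s₁ := s.image r), Finset.sum_image hinj]
      · convert hsum using 1
        refine Finset.sum_congr rfl fun i hi => ?_
        simp only [ha i hi, if_pos (Finset.mem_image_of_mem r hi), hg i hi]
      · exact Finset.image_subset_iff.2 hr
      · intro ρ _ h
        simp only [a, if_neg h, Rat.cast_zero, zero_smul]
  obtain ⟨c, hc⟩ := hloc τ hτ (by rw [hdim]) a hbal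
  obtain ⟨i, hi⟩ := hs
  have hc0 : c ≠ 0 := by
    rintro rfl
    have := hc _ (hr i hi)
    rw [ha i hi, zero_mul] at this
    exact hw i hi this
  by_contra hcon
  have hnot : ρ ∉ s.image r := by simpa using hcon
  have h := hc ρ hρ
  obtain ⟨hρD, -, hρdim⟩ := PureFan.mem_star.1 hρ
  have hz : a ρ = 0 := if_neg hnot
  rw [hz] at h
  exact mul_ne_zero hc0 (D.weight_ne_zero ρ hρD hρdim) h.symm

variable [FiniteDimensional ℝ V]

theorem span_pair_eq_of_mem {p q x z : V} (hp : p ≠ 0)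
    (hq : q ∉ Submodule.span ℝ ({p} : Set V)) (hx : x ≠ 0)
    (hz : z ∉ Submodule.span ℝ ({x} : Set V)) (hxW : x ∈ Submodule.span ℝ ({p, q} : Set V))
    (hzW : z ∈ Submodule.span ℝ ({p, q} : Set V)) :
    Submodule.span ℝ ({x, z} : Set V) = Submodule.span ℝ {p, q} := by
  refine Submodule.eq_of_le_of_finrank_eq (Submodule.span_le.2 ?_) ?_
  · rintro y (rfl | rfl) <;> assumption
  · rw [finrank_span_pair hx hz, finrank_span_pair hp hq]

namespace TropicalCycle

/-- Near an interior point of a two-dimensional cone, the support of a surface is planar. -/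
theorem mem_span_of_mem_interior (hsub : Y.support ⊆ D.support) {p q : V} (hp : p ≠ 0)
    (hq : q ∉ Submodule.span ℝ ({p} : Set V)) (hσ : PointedCone.hull ℝ {p, q} ∈ D.cones)
    {a b : ℝ} (ha : 0 < a) (hb : 0 < b) {C : PointedCone ℝ V} (hC : C ∈ Y.cones)
    (hx : a • p + b • q ∈ C) {y : V} (hy : y ∈ C) : y ∈ Submodule.span ℝ ({p, q} : Set V) := by
  obtain ⟨ρ, hρ, hxρ, t, ht, -, htρ⟩ := D.exists_cone_of_segment (x := a • p + b • q) (y := y)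
    fun t ht _ => hsub <| PureFan.mem_support.2
      ⟨C, hC, add_mem hx (PointedCone.smul_mem _ ht.le hy)⟩
  -- The face `σ ⊓ ρ` of `σ` contains an interior point, hence both generators. As `ρ` is at most
  -- two-dimensional, it spans the same plane.
  have hface := D.inter_face _ hσ ρ hρ
  have hpσ : p ∈ PointedCone.hull ℝ ({p, q} : Set V) := PointedCone.subset_hull (by simp)
  have hqσ : q ∈ PointedCone.hull ℝ ({p, q} : Set V) := PointedCone.subset_hull (by simp)
  have hxσ : a • p + b • q ∈ PointedCone.hull ℝ ({p, q} : Set V) ⊓ ρ :=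
    ⟨PointedCone.mem_hull_pair.2 ⟨a, b, ha.le, hb.le, rfl⟩, hxρ⟩
  have hpρ := (hface.mem_of_smul_add_smul_mem_left hpσ hqσ ha hb hxσ).2
  have hqρ := (hface.mem_of_smul_add_smul_mem_right hpσ hqσ ha hb hxσ).2
  have hspan : Submodule.span ℝ ({p, q} : Set V) = coneSpan ρ := by
    refine Submodule.eq_of_le_of_finrank_le (Submodule.span_le.2 ?_) ?_
    · rintro v (rfl | rfl)
      exacts [mem_coneSpan hpρ, mem_coneSpan hqρ]
    · rw [finrank_span_pair hp hq]
      exact D.coneDim_le hρ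
  rw [hspan]
  have h1 := sub_mem (mem_coneSpan htρ) (mem_coneSpan hxρ)
  rw [add_sub_cancel_left] at h1
  exact (Submodule.smul_mem_iff _ ht.ne').1 h1

/-- Near an interior point the subcycle is planar, so `exists_opposite_side` provides cones of `Y`
on both sides of `x`; one of them is on the side of `d`. -/
theorem exists_segment_of_mem_interior (hsub : Y.support ⊆ D.support) {p q : V} (hp : p ≠ 0)
    (hq : q ∉ Submodule.span ℝ ({p} : Set V)) (hσ : PointedCone.hull ℝ {p, q} ∈ D.cones)
    {a b : ℝ} (ha : 0 < a) (hb : 0 < b) (hx : a • p + b • q ∈ Y.support) {d : V}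
    (hd : d ∈ Submodule.span ℝ ({p, q} : Set V))
    (hdx : d ∉ Submodule.span ℝ ({a • p + b • q} : Set V)) :
    ∃ ε > 0, ∀ s : ℝ, 0 ≤ s → s ≤ ε → a • p + b • q + s • d ∈ Y.support := by
  have hplane := fun C (hC : C ∈ Y.cones) hx y (hy : y ∈ C) =>
    mem_span_of_mem_interior hsub hp hq hσ ha hb hC hx hy
  set x := a • p + b • q with hxdef
  have hxs : x ∈ Submodule.span ℝ ({p, q} : Set V) := Submodule.mem_span_pair.2 ⟨a, b, rfl⟩
  have hx0 : x ≠ 0 := fun h0 => by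
    refine ha.ne' (eq_of_smul_add_smul_eq hp hq (b := b) (c := 0) (d := 0) ?_).1
    rw [← hxdef, h0]
    simp
  have hxd := span_pair_eq_of_mem hp hq hx0 hdx hxs hd
  obtain ⟨C, hC, hxC, hdim⟩ := PureFan.exists_maximal_cone hx
  obtain ⟨z, hzC, hz⟩ := exists_mem_notMem_span hdim x
  have hzs := hplane C hC hxC z hzC
  have hxz := span_pair_eq_of_mem hp hq hx0 hz hxs hzs
  rw [← hxd] at hzs
  obtain ⟨α, β, hαβ⟩ := Submodule.mem_span_pair.1 hzs
  have key : ∃ C' ∈ Y.cones, x ∈ C' ∧ ∃ α β : ℝ, 0 < β ∧ α • x + β • d ∈ C' := by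
    rcases lt_trichotomy β 0 with hβ | rfl | hβ
    · obtain ⟨C', hC', hxC', α', β', hβ', h⟩ := Y.exists_opposite_side hC hdim hx0 hxC hzC hz
        fun C' hC' hxC' y hy => hxz ▸ hplane C' hC' hxC' y hy
      refine ⟨C', hC', hxC', α' + β' * α, β' * β, mul_pos_of_neg_of_neg hβ' hβ, ?_⟩
      rw [← hαβ] at h
      convert h using 1
      module
    · refine absurd (Submodule.mem_span_singleton.2 ⟨α, ?_⟩) hz
      rw [← hαβ, zero_smul, add_zero]
    · exact ⟨C, hC, hxC, α, β, hβ, hαβ ▸ hzC⟩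
  obtain ⟨C', hC', hxC', α, β, hβ, h⟩ := key
  -- For such `s` the point `x + s • d` is a combination of `x` and `α • x + β • d` with
  -- coefficients `1 - s / β * α` and `s / β`, both non-negative.
  refine ⟨β / (|α| + 1), by positivity, fun s hs hsε => PureFan.mem_support.2 ⟨C', hC', ?_⟩⟩
  have hs1 : s / β * (|α| + 1) ≤ 1 := by
    rw [le_div_iff₀ (by positivity)] at hsε
    rw [div_mul_eq_mul_div, div_le_one hβ]
    exact hsε
  have hsβ : 0 ≤ s / β := by positivity
  have hcoef : 0 ≤ 1 - s / β * α := by nlinarith [le_abs_self α]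
  have heq : x + s • d = (1 - s / β * α) • x + (s / β) • (α • x + β • d) := by
    have : s = s / β * β := (div_mul_cancel₀ s hβ.ne').symm
    nth_rewrite 1 [this]
    module
  rw [heq]
  exact add_mem (PointedCone.smul_mem _ hcoef hxC') (PointedCone.smul_mem _ hsβ h)

/-- The positive `t` with `p + t • q ∈ |Y|` form an open and closed subset of the connected interval
$(0,\infty)$; the end `t = 0` follows by closure. -/
theorem line_mem_support (hsub : Y.support ⊆ D.support) {p q : V} (hp : p ≠ 0)
    (hq : q ∉ Submodule.span ℝ ({p} : Set V)) (hσ : PointedCone.hull ℝ {p, q} ∈ D.cones)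
    {t₀ : ℝ} (ht₀ : 0 < t₀) (hx : p + t₀ • q ∈ Y.support) {t : ℝ} (ht : 0 ≤ t) :
    p + t • q ∈ Y.support := by
  set T : Set ℝ := {t : ℝ | p + t • q ∈ Y.support} with hT
  have hclosed : IsClosed T := Y.isClosed_line p q
  have hopen : IsOpen (T ∩ Set.Ioi 0) := by
    rw [isOpen_iff_mem_nhds]
    rintro t ⟨htT, ht0 : 0 < t⟩
    refine inter_mem ?_ (Ioi_mem_nhds ht0)
    have hmem : (1 : ℝ) • p + t • q ∈ Y.support := by rwa [one_smul]
    have hdir : ∀ η : ℝ, η ≠ 0 → ∃ ε > 0, ∀ s : ℝ, 0 ≤ s → s ≤ ε → t + s * η ∈ T := by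
      intro η hη
      obtain ⟨ε, hε, h⟩ := exists_segment_of_mem_interior hsub hp hq hσ one_pos ht0 hmem
        (d := η • q) (Submodule.mem_span_pair.2 ⟨0, η, by simp⟩) (by
          intro hcon
          obtain ⟨c, hc⟩ := Submodule.mem_span_singleton.1 hcon
          have h2 : c • p + (c * t) • q = (0 : ℝ) • p + η • q := by
            rw [zero_smul, zero_add, ← hc]
            module
          obtain ⟨rfl, h3⟩ := eq_of_smul_add_smul_eq hp hq h2
          exact hη (by simpa using h3.symm))
      refine ⟨ε, hε, fun s hs hsε => ?_⟩
      have := h s hs hsε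
      change p + (t + s * η) • q ∈ Y.support
      convert this using 1
      module
    obtain ⟨ε, hε, h⟩ := hdir 1 one_ne_zero
    obtain ⟨ε', hε', h'⟩ := hdir (-1) (by norm_num)
    refine mem_of_superset (Icc_mem_nhds (sub_lt_self t hε') (lt_add_of_pos_right t hε)) ?_
    rintro r ⟨hr1, hr2⟩
    rcases le_total t r with hr | hr
    · have := h (r - t) (by linarith) (by linarith)
      rwa [mul_one, add_sub_cancel] at this
    · have := h' (t - r) (by linarith) (by linarith)
      convert this using 1
      ring
  have hIoi : Set.Ioi (0 : ℝ) ⊆ T := by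
    refine subset_trans (isPreconnected_Ioi.subset_of_closure_inter_subset hopen
      ⟨t₀, ht₀, hx, ht₀⟩ ?_) Set.inter_subset_left
    rintro r ⟨hr, hr0⟩
    exact ⟨hclosed.closure_subset (closure_mono Set.inter_subset_left hr), hr0⟩
  have hIci : Set.Ici (0 : ℝ) ⊆ T := by
    rw [← closure_Ioi]
    exact closure_minimal hIoi hclosed
  exact hIci ht

/-- A subcycle of a surface that meets the interior of a two-dimensional cone contains this
cone. -/
theorem hull_pair_subset_support (hsub : Y.support ⊆ D.support) {p q : V} (hp : p ≠ 0)
    (hq : q ∉ Submodule.span ℝ ({p} : Set V)) (hσ : PointedCone.hull ℝ {p, q} ∈ D.cones)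
    {a b : ℝ} (ha : 0 < a) (hb : 0 < b) (hx : a • p + b • q ∈ Y.support) {x : V}
    (hxσ : x ∈ PointedCone.hull ℝ ({p, q} : Set V)) : x ∈ Y.support := by
  have h1 : p + (a⁻¹ * b) • q ∈ Y.support := by
    have := Y.smul_mem_support hx (inv_nonneg.2 ha.le)
    rwa [smul_add, smul_smul, smul_smul, inv_mul_cancel₀ ha.ne', one_smul] at this
  have h2 : q + (b⁻¹ * a) • p ∈ Y.support := by
    have := Y.smul_mem_support hx (inv_nonneg.2 hb.le)
    rwa [smul_add, smul_smul, smul_smul, inv_mul_cancel₀ hb.ne', one_smul, add_comm] at this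
  obtain ⟨c, d, hc, hd, rfl⟩ := PointedCone.mem_hull_pair.1 hxσ
  rcases hc.eq_or_lt with rfl | hc
  · have := line_mem_support hsub (ne_zero_of_notMem_span hq) (notMem_span_singleton_comm hp hq)
      (by rwa [Set.pair_comm]) (by positivity) h2 le_rfl
    rw [zero_smul, add_zero] at this
    rw [zero_smul, zero_add]
    exact Y.smul_mem_support this hd
  · have := Y.smul_mem_support (line_mem_support hsub hp hq hσ (by positivity) h1
      (t := c⁻¹ * d) (by positivity)) hc.le
    rwa [smul_add, smul_smul, ← mul_assoc, mul_inv_cancel₀ hc.ne', one_mul] at this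

/-- A subcycle of a surface meets the interior of a two-dimensional cone. -/
theorem exists_mem_interior (hsub : Y.support ⊆ D.support)
    (hD : ∀ σ ∈ D.cones, coneDim σ = 2 → ∃ p q : V, p ≠ 0 ∧
      q ∉ Submodule.span ℝ ({p} : Set V) ∧ σ = PointedCone.hull ℝ {p, q}) :
    ∃ p q : V, p ≠ 0 ∧ q ∉ Submodule.span ℝ ({p} : Set V) ∧
      PointedCone.hull ℝ {p, q} ∈ D.cones ∧
      ∃ a b : ℝ, 0 < a ∧ 0 < b ∧ a • p + b • q ∈ Y.support := by
  obtain ⟨C₀, hC₀⟩ := Y.nonempty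
  obtain ⟨C, hC, -, hdim⟩ := Y.pure C₀ hC₀
  obtain ⟨x, hxC, hx⟩ := exists_mem_notMem_span hdim 0
  replace hx := ne_zero_of_notMem_span hx
  obtain ⟨z, hzC, hz⟩ := exists_mem_notMem_span hdim x
  have hseg : ∀ t : ℝ, 0 < t → x + t • z ∈ C := fun t ht =>
    add_mem hxC (PointedCone.smul_mem _ ht.le hzC)
  obtain ⟨ρ, hρ, hxρ, t, ht, -, htρ⟩ := D.exists_cone_of_segment (x := x) (y := z)
    fun t ht _ => hsub (PureFan.mem_support.2 ⟨C, hC, hseg t ht⟩)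
  obtain ⟨σ, hσ, hle, hσdim⟩ := D.pure ρ hρ
  obtain ⟨p, q, hp, hq, rfl⟩ := hD σ hσ hσdim
  obtain ⟨a, b, ha, hb, hxab⟩ := PointedCone.mem_hull_pair.1 (hle hxρ)
  obtain ⟨a', b', ha', hb', hyab⟩ := PointedCone.mem_hull_pair.1 (hle htρ)
  have hmultiple : ∀ c d : ℝ, ∀ v : V, x = c • v → x + t • z = d • v → False := by
    intro c d v hc hd
    have hc0 : c ≠ 0 := by
      rintro rfl
      simp [hx] at hc
    have hxv : v ∈ Submodule.span ℝ ({x} : Set V) :=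
      Submodule.mem_span_singleton.2 ⟨c⁻¹, by rw [hc, smul_smul, inv_mul_cancel₀ hc0, one_smul]⟩
    have h1 := Submodule.smul_mem _ d hxv
    rw [← hd] at h1
    have h2 := (Submodule.add_mem_iff_right _ (Submodule.mem_span_singleton_self x)).1 h1
    exact hz ((Submodule.smul_mem_iff _ ht.ne').1 h2)
  -- Two non-proportional points of the cone do not lie on a common boundary ray, so their sum is an
  -- interior point.
  refine ⟨p, q, hp, hq, hσ, a + a', b + b', ?_, ?_, PureFan.mem_support.2 ⟨C, hC, ?_⟩⟩
  · refine lt_of_le_of_ne (by positivity) fun h => ?_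
    obtain ⟨rfl, rfl⟩ : a = 0 ∧ a' = 0 := by constructor <;> linarith
    exact hmultiple b b' q (by simpa using hxab) (by simpa using hyab)
  · refine lt_of_le_of_ne (by positivity) fun h => ?_
    obtain ⟨rfl, rfl⟩ : b = 0 ∧ b' = 0 := by constructor <;> linarith
    exact hmultiple a a' p (by simpa using hxab) (by simpa using hyab)
  · have : (a + a') • p + (b + b') • q = x + (x + t • z) := by
      rw [hyab, hxab]
      module
    rw [this]
    exact add_mem hxC (hseg t ht)

theorem exists_star_of_mem (hsub : Y.support ⊆ D.support) {p : V} (hp : p ≠ 0)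
    (hτ : PointedCone.hull ℝ {p} ∈ D.cones) {C : PointedCone ℝ V} (hC : C ∈ Y.cones)
    (hpC : p ∈ C) {z : V} (hzC : z ∈ C) (hz : z ∉ Submodule.span ℝ ({p} : Set V)) :
    ∃ ρ ∈ D.star (PointedCone.hull ℝ {p}), ∃ t : ℝ, 0 < t ∧ p + t • z ∈ ρ ∧ p + t • z ∈ C := by
  have hseg : ∀ t : ℝ, 0 < t → p + t • z ∈ C := fun t ht =>
    add_mem hpC (PointedCone.smul_mem _ ht.le hzC)
  obtain ⟨ρ, hρ, hpρ, t, ht, -, htρ⟩ := D.exists_cone_of_segment (x := p) (y := z)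
    fun t ht _ => hsub (PureFan.mem_support.2 ⟨C, hC, hseg t ht⟩)
  refine ⟨ρ, PureFan.mem_star.2 ⟨hρ, ?_, ?_⟩, t, ht, htρ, hseg t ht⟩
  · exact D.isFaceOf_of_mem hτ hρ (PointedCone.subset_hull rfl) hpρ (coneSpan_hull _).le
  · refine le_antisymm (D.coneDim_le hρ) ?_
    have hy := smul_add_smul_notMem_span hz 1 ht.ne'
    rw [one_smul] at hy
    rw [← finrank_span_pair hp hy]
    refine Submodule.finrank_mono (Submodule.span_le.2 ?_)
    rintro v (rfl | rfl)
    exacts [mem_coneSpan hpρ, mem_coneSpan htρ]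

/-- A subcycle of a locally irreducible surface through a ray meets the interior of every
two-dimensional cone at this ray. -/
theorem IsLocallyIrreducible.exists_mem_of_mem_star (hloc : D.IsLocallyIrreducible)
    (hsub : Y.support ⊆ D.support) {p : V} (hp : p ≠ 0) (hτ : PointedCone.hull ℝ {p} ∈ D.cones)
    (hpY : p ∈ Y.support) {ρ : PointedCone ℝ V} (hρ : ρ ∈ D.star (PointedCone.hull ℝ {p})) :
    ∃ y ∈ ρ, y ∉ Submodule.span ℝ ({p} : Set V) ∧ p + y ∈ Y.support := by
  classical
  set τ := PointedCone.hull ℝ ({p} : Set V) with hτdef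
  have hτspan : coneSpan τ = Submodule.span ℝ {p} := coneSpan_hull _
  have hτdim := coneDim_eq_one_of_coneSpan hp hτspan
  have hpτ : p ∈ τ := PointedCone.subset_hull rfl
  obtain ⟨C, hC, hpC, hdim⟩ := PureFan.exists_maximal_cone hpY
  obtain ⟨z, hzC, hz⟩ := exists_mem_notMem_span hdim p
  rcases Y.exists_opposite_or_face hC hdim hp hpC hzC hz with ⟨α, β, hβ, h⟩ |
    ⟨F, hF, hpF, hFC, hFspan⟩
  -- First case: `C` extends to both sides of `p`. It then enters two cones of the star of `D` that
  -- lie in one plane on opposite sides of the ray. Their normals can be taken as `u` and `-u`, so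
  -- the weights 1 and 1 balance and these two cones are the whole star.
  · obtain ⟨ρ₁, hρ₁, t, ht, h1ρ, h1C⟩ := exists_star_of_mem hsub hp hτ hC hpC hzC hz
    obtain ⟨ρ₂, hρ₂, t', ht', h2ρ, h2C⟩ := exists_star_of_mem hsub hp hτ hC hpC h
      (smul_add_smul_notMem_span hz α hβ.ne)
    obtain ⟨A, B, hB, hAB⟩ : ∃ A B : ℝ, B < 0 ∧
        p + t' • (α • p + β • z) = A • p + B • (p + t • z) := by
      refine ⟨1 + t' * α - t' * β / t, t' * β / t,
        div_neg_of_neg_of_pos (mul_neg_of_pos_of_neg ht' hβ) ht, ?_⟩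
      have : t' * β = t' * β / t * t := (div_mul_cancel₀ _ ht.ne').symm
      calc p + t' • (α • p + β • z) = (1 + t' * α) • p + (t' * β) • z := by module
        _ = (1 + t' * α) • p + (t' * β / t * t) • z := by rw [← this]
        _ = _ := by module
    have hy₁ := smul_add_smul_notMem_span hz 1 ht.ne'
    rw [one_smul] at hy₁
    rw [hAB] at h2ρ h2C
    generalize p + t • z = y₁ at *
    have hy₂ := smul_add_smul_notMem_span hy₁ A hB.ne
    generalize hy₂def : A • p + B • y₁ = y₂ at *
    obtain ⟨hρ₁D, hface₁, hdim₁⟩ := PureFan.mem_star.1 hρ₁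
    obtain ⟨hρ₂D, hface₂, hdim₂⟩ := PureFan.mem_star.1 hρ₂
    have hspan₁ := coneSpan_eq_span_pair hdim₁ (hface₁.le hpτ) h1ρ hp hy₁
    have hspan : coneSpan ρ₂ = coneSpan ρ₁ := by
      rw [coneSpan_eq_span_pair hdim₂ (hface₂.le hpτ) h2ρ hp hy₂, hspan₁,
        ← coneSpan_eq_span_pair hdim hpC h1C hp hy₁,
        ← coneSpan_eq_span_pair hdim hpC h2C hp hy₂]
    have hne : ρ₁ ≠ ρ₂ := by
      rintro rfl
      rw [← hy₂def] at h2ρ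
      exact absurd (hface₁.nonneg_of_mem hpτ hτspan h1ρ hy₁ h2ρ) (not_le.2 hB)
    obtain ⟨u₀, hu₀, -⟩ := D.balanced τ hτ (by rw [hτdim])
    have hu₁ := hu₀ ρ₁ hρ₁
    generalize u₀ ρ₁ = u at hu₁
    have hu₂ : IsLatticeNormal Λ ρ₂ τ (-u) := by
      obtain ⟨hu, ⟨x, hx, hux⟩, hgen⟩ := hu₁
      refine ⟨neg_mem hu, ?_, fun y hy hyρ => ?_⟩
      · have hxs := mem_coneSpan hx
        rw [hspan₁] at hxs
        obtain ⟨c, d, rfl⟩ := Submodule.mem_span_pair.1 hxs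
        have hd := hface₁.nonneg_of_mem hpτ hτspan h1ρ hy₁ hx
        refine ⟨(d / -B) • y₂, PointedCone.smul_mem _ (div_nonneg hd (by linarith)) h2ρ, ?_⟩
        have hdB : d / -B * B = -d := by
          rw [div_neg, neg_mul, div_mul_cancel₀ _ hB.ne]
        have heq : -u - (d / -B) • y₂ = -(u - (c • p + d • y₁)) + (-c - d / -B * A) • p := by
          rw [← hy₂def, smul_add, smul_smul, smul_smul, hdB]
          module
        rw [heq, hτspan]
        rw [hτspan] at hux
        exact add_mem (neg_mem hux)
          (Submodule.smul_mem _ _ (Submodule.mem_span_singleton_self p))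
      · obtain ⟨m, hm⟩ := hgen y hy (hspan ▸ hyρ)
        exact ⟨-m, by rwa [neg_smul_neg]⟩
    obtain ⟨i, -, hi⟩ := hloc.exists_eq_of_balanced hτ hτdim (Finset.univ : Finset Bool)
      Finset.univ_nonempty (fun i => bif i then ρ₁ else ρ₂) (by
        rintro (_ | _) -
        exacts [hρ₂, hρ₁])
      (by
        rintro (_ | _) - (_ | _) - h
        exacts [rfl, absurd h.symm hne, absurd h hne, rfl])
      (fun _ => 1) (by simp) (fun i => bif i then u else -u) (by simp [hu₁, hu₂]) (by simp) hρ
    subst hi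
    cases i
    · exact ⟨y₂, h2ρ, hy₂, PureFan.mem_support.2 ⟨C, hC, add_mem hpC h2C⟩⟩
    · exact ⟨y₁, h1ρ, hy₁, PureFan.mem_support.2 ⟨C, hC, add_mem hpC h1C⟩⟩
  -- Second case: `p` spans a face `F` of `C`. Each cone of `Y` at `F` starts inside a cone of `D`
  -- at `τ`.
  · have hex : ∀ C' ∈ Y.star F, ∃ ρ ∈ D.star τ, ∃ y ∈ ρ, y ∈ C' ∧
        y ∉ Submodule.span ℝ ({p} : Set V) := by
      intro C' hC'
      obtain ⟨hC'Y, hFC', hdim'⟩ := PureFan.mem_star.1 hC'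
      obtain ⟨z', hz'C, hz'⟩ := exists_mem_notMem_span hdim' p
      obtain ⟨ρ, hρ, t, ht, h1, h2⟩ :=
        exists_star_of_mem hsub hp hτ hC'Y (hFC'.le hpF) hz'C hz'
      have hy := smul_add_smul_notMem_span hz' 1 ht.ne'
      rw [one_smul] at hy
      exact ⟨ρ, hρ, _, h1, h2, hy⟩
    choose! r hr y hyr hyC hy using hex
    have hFdim := coneDim_eq_one_of_coneSpan hp hFspan
    obtain ⟨u, hu, hsum⟩ := Y.balanced F hF (by rw [hFdim])
    have hCF : C ∈ Y.star F := PureFan.mem_star.2 ⟨hC, hFC, hdim⟩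
    have hspanr : ∀ C' ∈ Y.star F, coneSpan (r C') = Submodule.span ℝ {p, y C'} := by
      intro C' hC'
      obtain ⟨-, hface, hdim'⟩ := PureFan.mem_star.1 (hr C' hC')
      exact coneSpan_eq_span_pair hdim' (hface.le hpτ) (hyr C' hC') hp (hy C' hC')
    have hspanC : ∀ C' ∈ Y.star F, coneSpan C' = Submodule.span ℝ {p, y C'} := by
      intro C' hC'
      obtain ⟨-, hface, hdim'⟩ := PureFan.mem_star.1 hC'
      exact coneSpan_eq_span_pair hdim' (hface.le hpF) (hyC C' hC') hp (hy C' hC')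
    -- The weights of `Y` are carried over to `D`. The assignment `r` is injective because cones of
    -- `Y` on the same side coincide, and normals carry over because `F` and `τ`, as well as `C'`
    -- and `r C'`, have equal spans.
    obtain ⟨C', hC', rfl⟩ := hloc.exists_eq_of_balanced hτ hτdim (Y.star F) ⟨C, hCF⟩ r hr
      (by
        intro C₁ h1 C₂ h2 h12
        have h1' := PureFan.mem_star.1 h1
        have h2' := PureFan.mem_star.1 h2
        have hface := (PureFan.mem_star.1 (hr C₁ h1)).2.1
        have hy2 : y C₂ ∈ r C₁ := h12 ▸ hyr C₂ h2
        have hys := mem_coneSpan hy2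
        rw [hspanr C₁ h1] at hys
        obtain ⟨α, β, hαβ⟩ := Submodule.mem_span_pair.1 hys
        have hβ : 0 < β := by
          refine lt_of_le_of_ne (hface.nonneg_of_mem hpτ hτspan (hyr C₁ h1) (hy C₁ h1)
            (α := α) (hαβ ▸ hy2)) ?_
          rintro rfl
          refine hy C₂ h2 (Submodule.mem_span_singleton.2 ⟨α, ?_⟩)
          rw [← hαβ, zero_smul, add_zero]
        exact Y.eq_of_same_side h1'.1 h2'.1 h1'.2.2 h2'.2.2 hp (h1'.2.1.le hpF) (h2'.2.1.le hpF)
          (hyC C₁ h1) (hy C₁ h1) hβ (α := α) (hαβ ▸ hyC C₂ h2))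
      Y.weight
      (fun C' hC' => Y.weight_ne_zero C' (PureFan.mem_star.1 hC').1 (PureFan.mem_star.1 hC').2.2)
      u
      (by
        intro C' hC'
        obtain ⟨huΛ, ⟨x, hx, hux⟩, hgen⟩ := hu C' hC'
        rw [hFspan] at hux hgen
        refine ⟨huΛ, ?_, fun v hv hvr => ?_⟩
        · have hface := (PureFan.mem_star.1 hC').2.1
          have hxs := mem_coneSpan hx
          rw [hspanC C' hC'] at hxs
          obtain ⟨c, d, rfl⟩ := Submodule.mem_span_pair.1 hxs
          have hd := hface.nonneg_of_mem hpF hFspan (hyC C' hC') (hy C' hC') hx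
          refine ⟨d • y C', PointedCone.smul_mem _ hd (hyr C' hC'), ?_⟩
          have heq : u C' - d • y C' = (u C' - (c • p + d • y C')) + c • p := by module
          rw [heq, hτspan]
          exact add_mem hux (Submodule.smul_mem _ _ (Submodule.mem_span_singleton_self p))
        · rw [hτspan]
          exact hgen v hv (by rwa [hspanC C' hC', ← hspanr C' hC']))
      (by rwa [hτspan, ← hFspan]) hρ
    obtain ⟨hC'Y, hFC', -⟩ := PureFan.mem_star.1 hC'
    exact ⟨y C', hyr C' hC', hy C' hC',
      PureFan.mem_support.2 ⟨C', hC'Y, add_mem (hFC'.le hpF) (hyC C' hC')⟩⟩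

end TropicalCycle

end SubcyclesOfSurfaces

/-! ### Graphs on six vertices carried by tropical surfaces -/

namespace SixGraph

/-- A symmetric relation on six points in which every edge `ij` comes with a set `T` of further
points that span triangles with it, such that either all other points are pairwise adjacent or `T`
is non-empty and adjacent to all other points. -/
structure IsSaturated (G : Fin 6 → Fin 6 → Prop) : Prop where
  symm : ∀ i j, G i j → G j i
  exists_apex : ∀ i j, i ≠ j → G i j → ∃ T : Fin 6 → Prop,
    (∀ k, k ≠ i → k ≠ j → T k → G i k ∧ G j k) ∧
    ((∀ k l, k ≠ i → k ≠ j → l ≠ i → l ≠ j → k ≠ l → ¬ T k → ¬ T l → G k l) ∨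
      (∃ k, k ≠ i ∧ k ≠ j ∧ T k) ∧
        ∀ k l, k ≠ i → k ≠ j → l ≠ i → l ≠ j → T k → ¬ T l → G k l)

theorem IsSaturated.comap {G : Fin 6 → Fin 6 → Prop} (hG : IsSaturated G)
    (π : Equiv.Perm (Fin 6)) : IsSaturated fun i j => G (π i) (π j) where
  symm i j h := hG.symm _ _ h
  exists_apex i j hij h := by
    obtain ⟨T, h1, h2⟩ := hG.exists_apex (π i) (π j) (π.injective.ne hij) h
    have hne : ∀ {a b : Fin 6}, a ≠ b → π a ≠ π b := fun h => π.injective.ne h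
    refine ⟨fun k => T (π k), fun k hi hj => h1 _ (hne hi) (hne hj), ?_⟩
    rcases h2 with h2 | ⟨⟨k, hki, hkj, hk⟩, h2⟩
    · exact Or.inl fun k l a b c d e => h2 _ _ (hne a) (hne b) (hne c) (hne d) (hne e)
    · refine Or.inr ⟨⟨π.symm k, ?_, ?_, by simpa using hk⟩,
        fun k l a b c d => h2 _ _ (hne a) (hne b) (hne c) (hne d)⟩
      · rintro rfl
        simp at hki
      · rintro rfl
        simp at hkj

/-- A number encoding the edge between two vertices. -/
def edge (k l : Fin 6) : ℕ := 6 * min k.val l.val + max k.val l.val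

/-- The vertices different from `i` and `j`. -/
def others (i j : Fin 6) : List (Fin 6) :=
  (List.finRange 6).filter fun k => k != i && k != j

/-- The edge sets of which a saturated graph containing the edge `ij` must contain one. -/
def patterns (i j : Fin 6) : List (List ℕ) :=
  (others i j).sublists.flatMap fun T =>
    let N := (others i j).filter fun k => !T.contains k
    let B := edge i j :: T.flatMap fun k => [edge i k, edge j k]
    (B ++ N.flatMap fun k => (N.filter fun l => k != l).map fun l => edge k l) ::
      (if T.isEmpty then [] else [B ++ T.flatMap fun k => N.map fun l => edge k l])

/-- Discard the edges of `L` that do not lie in a saturated graph with edges in `L` for the reason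
that `L` contains none of the patterns at this edge. -/
def prune (L : List ℕ) : List ℕ :=
  L.filter fun c => (patterns (Fin.ofNat 6 (c / 6)) (Fin.ofNat 6 (c % 6))).any fun p =>
    p.all fun d => L.contains d

/-- The edges outside `p`. -/
def complement (p : List ℕ) : List ℕ :=
  ((List.finRange 6).flatMap fun k =>
    ((List.finRange 6).filter fun l => k < l).map fun l => edge k l).filter fun c => !p.contains c

/-- The number `c` encodes an edge of the graph `G`. -/
def HasEdge (G : Fin 6 → Fin 6 → Prop) (c : ℕ) : Prop :=
  ∃ k l, k ≠ l ∧ edge k l = c ∧ G k l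

theorem edge_eq_iff : ∀ {i j k l : Fin 6}, edge i j = edge k l → i = k ∧ j = l ∨ i = l ∧ j = k := by
  decide +kernel

theorem decode_edge : ∀ k l : Fin 6,
    (Fin.ofNat 6 (edge k l / 6) = k ∧ Fin.ofNat 6 (edge k l % 6) = l) ∨
      (Fin.ofNat 6 (edge k l / 6) = l ∧ Fin.ofNat 6 (edge k l % 6) = k) := by
  decide +kernel

theorem mem_others {i j k : Fin 6} : k ∈ others i j ↔ k ≠ i ∧ k ≠ j := by
  simp [others]

theorem IsSaturated.exists_pattern {G : Fin 6 → Fin 6 → Prop} (hG : IsSaturated G) {i j : Fin 6}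
    (hij : i ≠ j) (h : G i j) : ∃ p ∈ patterns i j, ∀ c ∈ p, HasEdge G c := by
  classical
  obtain ⟨T, h1, h2⟩ := hG.exists_apex i j hij h
  set T' := (others i j).filter fun k => T k with hT'
  have hmem : ∀ {k}, k ∈ T' ↔ (k ≠ i ∧ k ≠ j) ∧ T k := by
    simp [hT', mem_others]
  set N := (others i j).filter fun k => !T'.contains k with hN
  have hmemN : ∀ {k}, k ∈ N ↔ (k ≠ i ∧ k ≠ j) ∧ ¬ T k := by
    intro k
    simp only [hN, List.mem_filter, mem_others, Bool.not_eq_true', List.contains_eq_mem,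
      decide_eq_false_iff_not, hmem]
    tauto
  set B := edge i j :: T'.flatMap fun k => [edge i k, edge j k] with hB
  have hBG : ∀ c ∈ B, HasEdge G c := by
    intro c hc
    simp only [hB, List.mem_cons, List.mem_flatMap, List.not_mem_nil, or_false] at hc
    rcases hc with rfl | ⟨k, hk, rfl | rfl⟩
    · exact ⟨i, j, hij, rfl, h⟩
    · obtain ⟨⟨hi, hj⟩, hk⟩ := hmem.1 hk
      exact ⟨i, k, hi.symm, rfl, (h1 k hi hj hk).1⟩
    · obtain ⟨⟨hi, hj⟩, hk⟩ := hmem.1 hk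
      exact ⟨j, k, hj.symm, rfl, (h1 k hi hj hk).2⟩
  have hsub : T' ∈ (others i j).sublists := List.mem_sublists.2 List.filter_sublist
  rcases h2 with h2 | ⟨⟨k, hki, hkj, hk⟩, h2⟩
  · refine ⟨_, List.mem_flatMap.2 ⟨T', hsub, List.mem_cons_self⟩, fun c hc => ?_⟩
    rcases List.mem_append.1 hc with hc | hc
    · exact hBG c hc
    · simp only [List.mem_flatMap, List.mem_map] at hc
      obtain ⟨k, hk, l, hl, rfl⟩ := hc
      obtain ⟨hl, hkl⟩ := List.mem_filter.1 hl
      rw [bne_iff_ne] at hkl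
      obtain ⟨⟨a, b⟩, e⟩ := hmemN.1 hk
      obtain ⟨⟨a', b'⟩, e'⟩ := hmemN.1 hl
      exact ⟨k, l, hkl, rfl, h2 k l a b a' b' hkl e e'⟩
  · have hne : T'.isEmpty = false := by
      rw [List.isEmpty_eq_false_iff]
      exact List.ne_nil_of_mem (hmem.2 ⟨⟨hki, hkj⟩, hk⟩)
    refine ⟨B ++ T'.flatMap fun k => N.map fun l => edge k l,
      List.mem_flatMap.2 ⟨T', hsub, List.mem_cons_of_mem _ ?_⟩, fun c hc => ?_⟩
    · simp only [hne, Bool.false_eq_true, if_false]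
      exact List.mem_singleton.2 rfl
    · rcases List.mem_append.1 hc with hc | hc
      · exact hBG c hc
      · simp only [List.mem_flatMap, List.mem_map] at hc
        obtain ⟨k, hk, l, hl, rfl⟩ := hc
        obtain ⟨⟨a, b⟩, e⟩ := hmem.1 hk
        obtain ⟨⟨a', b'⟩, e'⟩ := hmemN.1 hl
        refine ⟨k, l, ?_, rfl, h2 k l a b a' b' e e'⟩
        rintro rfl
        exact e' e

/-- An edge of `G` comes with a pattern consisting of edges of `G`, all of which lie in `L`; so it
survives. -/
theorem IsSaturated.mem_prune {G : Fin 6 → Fin 6 → Prop} (hG : IsSaturated G) {L : List ℕ}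
    (hL : ∀ c, HasEdge G c → c ∈ L) (c : ℕ) (hc : HasEdge G c) : c ∈ prune L := by
  refine List.mem_filter.2 ⟨hL c hc, ?_⟩
  obtain ⟨k, l, hkl, rfl, h⟩ := hc
  have key : ∀ i j, i ≠ j → G i j →
      ((patterns i j).any fun p => p.all fun d => L.contains d) = true := by
    intro i j hij h
    obtain ⟨p, hp, hpG⟩ := hG.exists_pattern hij h
    simp only [List.any_eq_true, List.all_eq_true, List.contains_eq_mem, decide_eq_true_eq]
    exact ⟨p, hp, fun d hd => hL d (hpG d hd)⟩
  rcases decode_edge k l with ⟨h1, h2⟩ | ⟨h1, h2⟩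
  · rw [h1, h2]
    exact key k l hkl h
  · rw [h1, h2]
    exact key l k hkl.symm (hG.symm _ _ h)

/-- The finite check. Relabelling the vertices moves any given edge to 01, so the patterns at this
edge suffice; three rounds of pruning exhaust every complement. -/
theorem prune_complement_eq_nil :
    ∀ p ∈ patterns 0 1, prune (prune (prune (complement p))) = [] := by
  decide +kernel

theorem edge_mem_complement {k l : Fin 6} (hkl : k ≠ l) {p : List ℕ} (h : edge k l ∉ p) :
    edge k l ∈ complement p := by
  have hmem : ∀ k l : Fin 6, k ≠ l → edge k l ∈ (List.finRange 6).flatMap fun k =>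
      ((List.finRange 6).filter fun l => k < l).map fun l => edge k l := by
    decide +kernel
  exact List.mem_filter.2 ⟨hmem k l hkl, by simpa using h⟩

/-- Two saturated graphs on six vertices with at least one edge have a common edge. -/
theorem IsSaturated.exists_common_edge {G H : Fin 6 → Fin 6 → Prop} (hG : IsSaturated G)
    (hH : IsSaturated H) {i j : Fin 6} (hij : i ≠ j) (hGij : G i j) {k l : Fin 6} (hkl : k ≠ l)
    (hHkl : H k l) : ∃ a b, a ≠ b ∧ G a b ∧ H a b := by
  by_contra! hdis
  obtain ⟨π, hπ0, hπ1⟩ : ∃ π : Equiv.Perm (Fin 6), π 0 = i ∧ π 1 = j := by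
    refine ⟨(Equiv.swap 0 i).trans (Equiv.swap (Equiv.swap 0 i 1) j), ?_, ?_⟩
    · rw [Equiv.trans_apply, Equiv.swap_apply_left]
      refine Equiv.swap_apply_of_ne_of_ne ?_ hij
      rw [← Equiv.swap_apply_left 0 i]
      exact (Equiv.injective _).ne (by decide)
    · rw [Equiv.trans_apply, Equiv.swap_apply_left]
  have hG' := hG.comap π
  have hH' := hH.comap π
  obtain ⟨p, hp, hpG⟩ := hG'.exists_pattern (i := 0) (j := 1) (by decide) (by rwa [hπ0, hπ1])
  -- `H` avoids the pattern contained in `G`, so its edges lie in the complement, which pruning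
  -- empties.
  have h0 : ∀ c, HasEdge (fun i j => H (π i) (π j)) c → c ∈ complement p := by
    rintro c ⟨a, b, hab, rfl, h⟩
    refine edge_mem_complement hab fun hc => ?_
    obtain ⟨a', b', -, heq, h'⟩ := hpG _ hc
    rcases edge_eq_iff heq with ⟨rfl, rfl⟩ | ⟨rfl, rfl⟩
    · exact hdis _ _ (π.injective.ne hab) h' h
    · exact hdis _ _ (π.injective.ne hab) (hG.symm _ _ h') h
  have h3 := hH'.mem_prune (hH'.mem_prune (hH'.mem_prune h0))
  rw [prune_complement_eq_nil p hp] at h3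
  exact absurd (h3 _ ⟨π.symm k, π.symm l, π.symm.injective.ne hkl, rfl, by simpa using hHkl⟩)
    List.not_mem_nil

end SixGraph

/-! ### Quartet forms on split vectors -/

namespace TropicalM0

section Quartets

variable {n : ℕ}

/-- The coordinate of the pair `{i, j}`. -/
noncomputable def pairCoord (i j : Fin n) : (Pairs n → ℝ) →ₗ[ℝ] ℝ :=
  if h : i < j then LinearMap.proj ⟨(i, j), h⟩
  else if h : j < i then LinearMap.proj ⟨(j, i), h⟩ else 0

theorem pairCoord_phi {i j : Fin n} (hij : i ≠ j) (a : Fin n → ℝ) :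
    pairCoord i j (phi n a) = a i + a j := by
  rcases lt_or_gt_of_ne hij with h | h
  · simp [pairCoord, h, phi]
  · simp [pairCoord, h, not_lt_of_gt h, phi, add_comm]

/-- The length one if the split `I` separates `i` and `j`, zero otherwise. -/
def sep (I : Finset (Fin n)) (i j : Fin n) : ℤ :=
  if i ∈ I ↔ j ∈ I then 0 else 1

theorem pairCoord_split (I : Finset (Fin n)) (i j : Fin n) :
    pairCoord i j (fun p : Pairs n => if (p.1.1 ∈ I ↔ p.1.2 ∈ I) then (0 : ℝ) else 1) =
      (sep I i j : ℝ) := by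
  rcases lt_trichotomy i j with h | rfl | h
  · simp [pairCoord, h, sep]
  · simp [pairCoord, sep]
  · simp [pairCoord, h, not_lt_of_gt h, sep, iff_comm]

/-- Twice the length of the split `ab|cd` minus twice the length of the split `ac|bd` of the
subtree spanned by `a, b, c, d`. -/
def quartet (I : Finset (Fin n)) (a b c d : Fin n) : ℤ :=
  sep I a c + sep I b d - sep I a b - sep I c d

/-- Each of `a, b, c, d` occurs once with each sign, so this combination of coordinates kills the
image of $\Phi$. -/
theorem exists_form_quartet {a b c d : Fin n} (hab : a ≠ b) (hac : a ≠ c) (hbd : b ≠ d)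
    (hcd : c ≠ d) :
    ∃ f : Ambient n →ₗ[ℝ] ℝ, ∀ I, f (splitVector n I) = quartet I a b c d := by
  refine ⟨(LinearMap.range (phi n)).liftQ
    (pairCoord a c + pairCoord b d - pairCoord a b - pairCoord c d) ?_, fun I => ?_⟩
  · rintro _ ⟨x, rfl⟩
    simp only [LinearMap.mem_ker, LinearMap.sub_apply, LinearMap.add_apply, pairCoord_phi hab,
      pairCoord_phi hac, pairCoord_phi hbd, pairCoord_phi hcd]
    ring
  · rw [splitVector, Submodule.liftQ_apply]
    simp only [LinearMap.sub_apply, LinearMap.add_apply, pairCoord_split, quartet]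
    push_cast
    rfl

theorem splitVector_compl (I : Finset (Fin n)) : splitVector n Iᶜ = splitVector n I := by
  simp [splitVector, not_iff_not]

theorem even_quartet (I : Finset (Fin n)) (a b c d : Fin n) :
    ∃ m : ℤ, quartet I a b c d = 2 * m := by
  by_cases ha : a ∈ I <;> by_cases hb : b ∈ I <;> by_cases hc : c ∈ I <;> by_cases hd : d ∈ I <;>
    simp only [quartet, sep, ha, hb, hc, hd, if_true, if_false, iff_true, iff_false, not_true] <;>
    first | exact ⟨0, rfl⟩ | exact ⟨1, rfl⟩ | exact ⟨-1, rfl⟩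

theorem quartet_pos {I : Finset (Fin n)} {a b c d : Fin n} (h : 0 < quartet I a b c d) :
    (b ∈ I ↔ a ∈ I) ∧ (d ∈ I ↔ c ∈ I) ∧ ¬ (a ∈ I ↔ c ∈ I) := by
  by_cases ha : a ∈ I <;> by_cases hb : b ∈ I <;> by_cases hc : c ∈ I <;> by_cases hd : d ∈ I <;>
    simp [quartet, sep, ha, hb, hc, hd] at h ⊢

theorem quartet_eq_two {I : Finset (Fin n)} {a b c d : Fin n} (ha : a ∈ I) (hb : b ∈ I)
    (hc : c ∉ I) (hd : d ∉ I) : quartet I a b c d = 2 := by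
  simp [quartet, sep, ha, hb, hc, hd]

/-- The two sets define the same split. -/
def SameSplit (I J : Finset (Fin n)) : Prop := I = J ∨ I = Jᶜ

theorem SameSplit.symm {I J : Finset (Fin n)} (h : SameSplit I J) : SameSplit J I := by
  rcases h with rfl | rfl
  · exact Or.inl rfl
  · exact Or.inr (compl_compl J).symm

theorem SameSplit.splitVector_eq {I J : Finset (Fin n)} (h : SameSplit I J) :
    splitVector n I = splitVector n J := by
  rcases h with rfl | rfl
  · rfl
  · exact splitVector_compl J

theorem SameSplit.trans {I J K : Finset (Fin n)} (h : SameSplit I J) (h' : SameSplit J K) :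
    SameSplit I K := by
  rcases h with rfl | rfl
  · exact h'
  · rcases h' with rfl | rfl
    · exact Or.inr rfl
    · exact Or.inl (compl_compl K)

theorem Compatible.symm {I J : Finset (Fin n)} (h : Compatible I J) : Compatible J I := by
  rcases h with h | h | h | h
  · exact Or.inr (Or.inl h)
  · exact Or.inl h
  · exact Or.inr (Or.inr (Or.inl h.symm))
  · exact Or.inr (Or.inr (Or.inr (by rwa [Finset.union_comm])))

theorem Compatible.compl_right {I J : Finset (Fin n)} (h : Compatible I J) :
    Compatible I Jᶜ := by
  rcases h with h | h | h | h
  · refine Or.inr (Or.inr (Or.inl ?_))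
    exact Finset.disjoint_left.2 fun x hx hx' => (Finset.mem_compl.1 hx') (h hx)
  · refine Or.inr (Or.inr (Or.inr ?_))
    ext x
    have := @h x
    simp only [Finset.mem_union, Finset.mem_compl, Finset.mem_univ, iff_true]
    tauto
  · exact Or.inl fun x hx => Finset.mem_compl.2 (Finset.disjoint_left.1 h hx)
  · refine Or.inr (Or.inl fun x hx => ?_)
    have : x ∈ I ∪ J := h ▸ Finset.mem_univ x
    rcases Finset.mem_union.1 this with h | h
    · exact h
    · exact absurd h (Finset.mem_compl.1 hx)

theorem Compatible.congr_right {I J K : Finset (Fin n)} (h : Compatible I J)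
    (hJK : SameSplit J K) : Compatible I K := by
  rcases hJK.symm with rfl | rfl
  · exact h
  · exact h.compl_right

/-- Lets the empty set take the place of the second split when only one split has to be detected. -/
theorem compatible_empty_right (I : Finset (Fin n)) : Compatible I ∅ :=
  Or.inr (Or.inl (Finset.empty_subset I))

theorem IsSplit.not_sameSplit_empty {I : Finset (Fin n)} (hI : IsSplit n I) :
    ¬ SameSplit I ∅ := by
  rintro (rfl | rfl)
  · simp [IsSplit] at hI
  · simp [IsSplit] at hI

/-- Values of opposite sign mean that `I` induces $ab|cd$ and `J` induces $ac|bd$. Then all four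
intersections of sides of `I` and `J` are non-empty, which contradicts compatibility. -/
theorem quartet_nonneg {I J : Finset (Fin n)} (h : Compatible I J) {a b c d : Fin n}
    (hI : 0 < quartet I a b c d) : 0 ≤ quartet J a b c d := by
  obtain ⟨h1, h2, h3⟩ := quartet_pos hI
  by_contra! hneg
  have hJ : (c ∈ J ↔ a ∈ J) ∧ (d ∈ J ↔ b ∈ J) ∧ ¬ (a ∈ J ↔ b ∈ J) := by
    have : 0 < quartet J a c b d := by
      have : quartet J a c b d = -quartet J a b c d := by
        simp only [quartet]
        ring
      omega
    exact quartet_pos this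
  obtain ⟨h4, h5, h6⟩ := hJ
  have hcI : c ∈ I ↔ a ∉ I := by tauto
  have hbJ : b ∈ J ↔ a ∉ J := by tauto
  rw [hcI] at h2
  rw [hbJ] at h5
  have hcases : (∀ x, x ∈ I → x ∈ J) ∨ (∀ x, x ∈ J → x ∈ I) ∨ (∀ x, x ∈ I → x ∉ J) ∨
      ∀ x, x ∉ I → x ∈ J := by
    rcases h with h | h | h | h
    · exact Or.inl h
    · exact Or.inr (Or.inl h)
    · exact Or.inr (Or.inr (Or.inl fun x hx => Finset.disjoint_left.1 h hx))
    · exact Or.inr (Or.inr (Or.inr fun x hx =>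
        (Finset.mem_union.1 (h ▸ Finset.mem_univ x)).resolve_left hx))
  rcases hcases with h | h | h | h
  all_goals
    have ha := h a
    have hb := h b
    have hc := h c
    have hd := h d
    rw [h1, hbJ] at hb
    rw [hcI, h4] at hc
    rw [h2, h5] at hd
    clear h h1 h2 h3 h4 h5 h6 hcI hbJ hneg hI
    tauto

/-- Compatible splits can be told apart by a quartet, avoiding any third split. -/
theorem exists_quartet {K I J : Finset (Fin n)} (hK : IsSplit n K) (hKI : Compatible K I)
    (hI : ¬ SameSplit K I) (hJ : ¬ SameSplit K J) :
    ∃ a b c d : Fin n, a ≠ b ∧ a ≠ c ∧ b ≠ d ∧ c ≠ d ∧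
      quartet K a b c d = 2 ∧ quartet I a b c d = 0 ∧ quartet J a b c d ≤ 0 := by
  -- One marking can be fixed so that in every quartet across `K` through it, three of the four
  -- markings are on the same side of `I`.
  have hIs : (∃ a ∈ K, ∀ b ∈ K, ∀ c ∉ K, ∀ d ∉ K, quartet I a b c d = 0) ∨
      ∃ c ∉ K, ∀ a ∈ K, ∀ b ∈ K, ∀ d ∉ K, quartet I a b c d = 0 := by
    rcases hKI with h | h | h | h
    · right
      obtain ⟨c, hcI, hcK⟩ : ∃ c ∈ I, c ∉ K := by
        by_contra! hcon
        exact hI (Or.inl (Finset.Subset.antisymm h hcon))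
      refine ⟨c, hcK, fun a ha b hb d hd => ?_⟩
      simp [quartet, sep, hcI, h ha, h hb]
    · left
      obtain ⟨a, haK, haI⟩ : ∃ a ∈ K, a ∉ I := by
        by_contra! hcon
        exact hI (Or.inl (Finset.Subset.antisymm hcon h))
      refine ⟨a, haK, fun b hb c hc d hd => ?_⟩
      have hcI : c ∉ I := fun h' => hc (h h')
      have hdI : d ∉ I := fun h' => hd (h h')
      simp [quartet, sep, haI, hcI, hdI]
    · right
      rw [Finset.disjoint_left] at h
      obtain ⟨c, hcK, hcI⟩ : ∃ c, c ∉ K ∧ c ∉ I := by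
        by_contra! hcon
        refine hI (Or.inr ?_)
        ext x
        rw [Finset.mem_compl]
        exact ⟨fun hx => h hx, fun hx => by_contra fun hxK => hx (hcon x hxK)⟩
      refine ⟨c, hcK, fun a ha b hb d hd => ?_⟩
      simp [quartet, sep, hcI, h ha, h hb]
    · left
      have h' : ∀ x, x ∉ K → x ∈ I := fun x hx =>
        (Finset.mem_union.1 (h ▸ Finset.mem_univ x)).resolve_left hx
      obtain ⟨a, haK, haI⟩ : ∃ a ∈ K, a ∈ I := by
        by_contra! hcon
        refine hI (Or.inr ?_)
        ext x
        rw [Finset.mem_compl]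
        exact ⟨hcon x, fun hx => by_contra fun hxK => hx (h' x hxK)⟩
      refine ⟨a, haK, fun b hb c hc d hd => ?_⟩
      simp [quartet, sep, haI, h' c hc, h' d hd]
  have hcompl : 1 < (Kᶜ).card := by
    have := Finset.card_compl_add_card K
    have := hK.2
    simp only [Fintype.card_fin] at *
    omega
  -- If all quartets through the fixed marking were positive on `J`, then `J` would be constant on
  -- `K` and take the opposite value on `Kᶜ`, so it would be the same split.
  have hconst : ∀ e, (∀ x ∈ K, x ∈ J ↔ e) → (∀ x ∉ K, x ∈ J ↔ ¬ e) → False := by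
    intro e h1 h2
    by_cases he : e
    · refine hJ (Or.inl ?_)
      ext x
      by_cases hx : x ∈ K
      · simp [hx, (h1 x hx).2 he]
      · have := h2 x hx
        tauto
    · refine hJ (Or.inr ?_)
      ext x
      rw [Finset.mem_compl]
      by_cases hx : x ∈ K
      · have := h1 x hx
        tauto
      · have := h2 x hx
        tauto
  have hne : ∀ {x y}, x ∈ K → y ∉ K → x ≠ y := by
    rintro x _ hx hy rfl
    exact hy hx
  rcases hIs with ⟨a, ha, h⟩ | ⟨c, hc, h⟩
  · by_contra! hcon
    have hpos : ∀ b ∈ K, a ≠ b → ∀ c ∉ K, ∀ d ∉ K, c ≠ d →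
        (b ∈ J ↔ a ∈ J) ∧ (d ∈ J ↔ c ∈ J) ∧ ¬ (a ∈ J ↔ c ∈ J) := fun b hb hab c hc d hd hcd =>
      quartet_pos (hcon a b c d hab (hne ha hc) (hne hb hd) hcd (quartet_eq_two ha hb hc hd)
        (h b hb c hc d hd))
    obtain ⟨b₀, hb₀, hab₀⟩ := Finset.exists_mem_ne hK.1 a
    obtain ⟨c₀, hc₀, d₀, hd₀, hcd₀⟩ := Finset.one_lt_card.1 hcompl
    rw [Finset.mem_compl] at hc₀ hd₀
    refine hconst (a ∈ J) (fun x hx => ?_) fun x hx => ?_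
    · by_cases hax : a = x
      · rw [hax]
      · exact (hpos x hx hax c₀ hc₀ d₀ hd₀ hcd₀).1
    · obtain ⟨y, hy, hyx⟩ := Finset.exists_mem_ne hcompl x
      have := (hpos b₀ hb₀ hab₀.symm x hx y (Finset.mem_compl.1 hy) hyx.symm).2.2
      tauto
  · by_contra! hcon
    have hpos : ∀ a ∈ K, ∀ b ∈ K, a ≠ b → ∀ d ∉ K, c ≠ d →
        (b ∈ J ↔ a ∈ J) ∧ (d ∈ J ↔ c ∈ J) ∧ ¬ (a ∈ J ↔ c ∈ J) := fun a ha b hb hab d hd hcd =>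
      quartet_pos (hcon a b c d hab (hne ha hc) (hne hb hd) hcd (quartet_eq_two ha hb hc hd)
        (h a ha b hb d hd))
    obtain ⟨d₀, hd₀, hcd₀⟩ := Finset.exists_mem_ne hcompl c
    obtain ⟨a₀, ha₀, b₀, hb₀, hab₀⟩ := Finset.one_lt_card.1 hK.1
    rw [Finset.mem_compl] at hd₀
    refine hconst (c ∉ J) (fun x hx => ?_) fun x hx => ?_
    · obtain ⟨y, hy, hyx⟩ := Finset.exists_mem_ne hK.1 x
      have := (hpos x hx y hy hyx.symm d₀ hd₀ hcd₀.symm).2.2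
      tauto
    · by_cases hcx : c = x
      · rw [hcx, not_not]
      · have := (hpos a₀ ha₀ b₀ hb₀ hab₀ x hx hcx).2.1
        tauto

end Quartets

end TropicalM0

/-! ### Cones, lattice normals and balancing in terms of splits -/

namespace TropicalM0

section Surfaces

variable {n : ℕ}

theorem IsSplit.splitVector_ne_zero {I : Finset (Fin n)} (hI : IsSplit n I) :
    splitVector n I ≠ 0 := by
  intro h0
  obtain ⟨a, b, c, d, hab, hac, hbd, hcd, h, -⟩ := exists_quartet hI (compatible_empty_right I)
    hI.not_sameSplit_empty hI.not_sameSplit_empty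
  obtain ⟨f, hf⟩ := exists_form_quartet hab hac hbd hcd
  have := hf I
  rw [h0, map_zero, h] at this
  norm_num at this

theorem splitVector_notMem_span {I J : Finset (Fin n)} (hJ : IsSplit n J)
    (hc : Compatible I J) (hne : ¬ SameSplit J I) :
    splitVector n J ∉ Submodule.span ℝ ({splitVector n I} : Set (Ambient n)) := by
  intro h
  obtain ⟨r, hr⟩ := Submodule.mem_span_singleton.1 h
  obtain ⟨a, b, c, d, hab, hac, hbd, hcd, h1, h2, -⟩ := exists_quartet hJ hc.symm hne hne
  obtain ⟨f, hf⟩ := exists_form_quartet hab hac hbd hcd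
  have := hf J
  rw [← hr, map_smul, hf I, h1, h2] at this
  norm_num at this

/-- Otherwise some quartet form is 2 on `K`, 0 on `I` and at most 0 on `J`, which is impossible for
`β ≥ 0`. -/
theorem sameSplit_of_eq_smul_add_smul {I J K : Finset (Fin n)} (hK : IsSplit n K)
    (hKI : Compatible K I) (hI : ¬ SameSplit K I) {α β : ℝ} (hβ : 0 ≤ β)
    (h : splitVector n K = α • splitVector n I + β • splitVector n J) : SameSplit K J := by
  by_contra hJ
  obtain ⟨a, b, c, d, hab, hac, hbd, hcd, h1, h2, h3⟩ := exists_quartet hK hKI hI hJ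
  obtain ⟨f, hf⟩ := exists_form_quartet hab hac hbd hcd
  have h4 := congrArg f h
  rw [map_add, map_smul, map_smul, hf, hf, hf, h1, h2, smul_eq_mul, smul_eq_mul] at h4
  have h5 : ((quartet J a b c d : ℤ) : ℝ) ≤ 0 := by exact_mod_cast h3
  have := mul_nonpos_of_nonneg_of_nonpos hβ h5
  push_cast at h4
  linarith

/-- The splits are distinct and compatible, i.e. span a two-dimensional cone. -/
structure Adjacent (I J : Finset (Fin n)) : Prop where
  left : IsSplit n I
  right : IsSplit n J
  compatible : Compatible I J
  ne : ¬ SameSplit I J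

theorem Adjacent.symm {I J : Finset (Fin n)} (h : Adjacent I J) : Adjacent J I :=
  ⟨h.right, h.left, h.compatible.symm, fun hs => h.ne hs.symm⟩

theorem Adjacent.notMem_span {I J : Finset (Fin n)} (h : Adjacent I J) :
    splitVector n J ∉ Submodule.span ℝ ({splitVector n I} : Set (Ambient n)) :=
  splitVector_notMem_span h.right h.compatible fun hs => h.ne hs.symm

/-- The cone spanned by two splits. -/
noncomputable def cone₂ (I J : Finset (Fin n)) : PointedCone ℝ (Ambient n) :=
  PointedCone.hull ℝ {splitVector n I, splitVector n J}

/-- The ray spanned by a split. -/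
noncomputable def ray (I : Finset (Fin n)) : PointedCone ℝ (Ambient n) :=
  PointedCone.hull ℝ {splitVector n I}

theorem cone₂_comm (I J : Finset (Fin n)) : cone₂ I J = cone₂ J I := by
  rw [cone₂, cone₂, Set.pair_comm]

theorem coneSpan_ray (I : Finset (Fin n)) :
    coneSpan (ray I) = Submodule.span ℝ {splitVector n I} :=
  coneSpan_hull _

theorem IsSplit.coneDim_ray {I : Finset (Fin n)} (hI : IsSplit n I) : coneDim (ray I) = 1 :=
  coneDim_eq_one_of_coneSpan hI.splitVector_ne_zero (coneSpan_ray I)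

theorem Adjacent.coneDim_cone₂ {I J : Finset (Fin n)} (h : Adjacent I J) :
    coneDim (cone₂ I J) = 2 :=
  coneDim_hull_pair h.left.splitVector_ne_zero h.notMem_span

theorem Adjacent.isFaceOf {I J : Finset (Fin n)} (h : Adjacent I J) :
    (ray I).IsFaceOf (cone₂ I J) :=
  PointedCone.isFaceOf_hull_pair h.left.splitVector_ne_zero h.notMem_span

theorem Adjacent.sameSplit_of_cone₂_eq {I J K : Finset (Fin n)} (h : Adjacent I J)
    (heq : cone₂ I J = cone₂ I K) : SameSplit J K := by
  have hJ : splitVector n J ∈ cone₂ I K := heq ▸ PointedCone.subset_hull (by simp)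
  obtain ⟨α, β, -, hβ, h1⟩ := PointedCone.mem_hull_pair.1 hJ
  exact sameSplit_of_eq_smul_add_smul h.right h.symm.compatible h.symm.ne hβ h1

theorem exists_adjacent_of_coneDim {σ : PointedCone ℝ (Ambient n)} (hσ : σ ∈ cones n)
    (hdim : coneDim σ = 2) : ∃ I J, Adjacent I J ∧ σ = cone₂ I J := by
  obtain ⟨S, hS, hc, rfl⟩ := hσ
  have hrank : Module.finrank ℝ (Submodule.span ℝ (splitVector n '' S)) = 2 := by
    rw [← hdim, coneDim, coneSpan_hull]
  obtain ⟨I, hI⟩ : S.Nonempty := by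
    rw [Set.nonempty_iff_ne_empty]
    rintro rfl
    rw [Set.image_empty, Submodule.span_empty, finrank_bot] at hrank
    exact absurd hrank (by norm_num)
  -- `S` may contain a set together with its complement, so splits are compared up to complement.
  obtain ⟨J, hJ, hne⟩ : ∃ J ∈ S, ¬ SameSplit I J := by
    by_contra! hcon
    have hle : Submodule.span ℝ (splitVector n '' S) ≤
        Submodule.span ℝ ({splitVector n I} : Set (Ambient n)) := by
      refine Submodule.span_mono ?_
      rintro _ ⟨J, hJ, rfl⟩
      exact (hcon J hJ).splitVector_eq.symm
    have h1 := Submodule.finrank_mono hle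
    rw [finrank_span_singleton (hS I hI).splitVector_ne_zero] at h1
    omega
  have hadj : Adjacent I J := ⟨hS I hI, hS J hJ, hc I hI J hJ, hne⟩
  have hspan : Submodule.span ℝ {splitVector n I, splitVector n J} =
      Submodule.span ℝ (splitVector n '' S) := by
    refine Submodule.eq_of_le_of_finrank_eq (Submodule.span_mono ?_) ?_
    · rintro _ (rfl | rfl)
      exacts [⟨I, hI, rfl⟩, ⟨J, hJ, rfl⟩]
    · rw [hrank, finrank_span_pair hadj.left.splitVector_ne_zero hadj.notMem_span]
  refine ⟨I, J, hadj, ?_⟩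
  rw [cone₂]
  congr 1
  refine Set.Subset.antisymm ?_ ?_
  · rintro _ ⟨K, hK, rfl⟩
    -- A third split `K` would lie in the span of the other two, but a quartet form that is 2 on `K`
    -- and 0 on `I` can be chosen at most 0 on `J`, and by compatibility it is at least 0 there.
    by_contra hnot
    have hKI : ¬ SameSplit K I := fun h => hnot (Or.inl h.splitVector_eq)
    have hKJ : ¬ SameSplit K J := fun h => hnot (Or.inr h.splitVector_eq)
    have hmem : splitVector n K ∈ Submodule.span ℝ {splitVector n I, splitVector n J} :=
      hspan ▸ Submodule.subset_span ⟨K, hK, rfl⟩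
    obtain ⟨α, β, hαβ⟩ := Submodule.mem_span_pair.1 hmem
    obtain ⟨a, b, c, d, hab, hac, hbd, hcd, h1, h2, h3⟩ :=
      exists_quartet (hS K hK) (hc K hK I hI) hKI hKJ
    have h4 : quartet J a b c d = 0 :=
      le_antisymm h3 (quartet_nonneg (hc K hK J hJ) (by rw [h1]; norm_num))
    obtain ⟨f, hf⟩ := exists_form_quartet hab hac hbd hcd
    have h5 := hf K
    rw [← hαβ, map_add, map_smul, map_smul, hf, hf, h1, h2, h4] at h5
    norm_num at h5
  · rintro _ (rfl | rfl)
    exacts [⟨I, hI, rfl⟩, ⟨J, hJ, rfl⟩]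

variable {D : TropicalCycle (lattice n) 2}

theorem IsDivisor.exists_adjacent_of_mem_star (hD : IsDivisor n D) {I : Finset (Fin n)}
    (hI : IsSplit n I) {σ : PointedCone ℝ (Ambient n)} (hσ : σ ∈ D.star (ray I)) :
    ∃ J, Adjacent I J ∧ σ = cone₂ I J := by
  obtain ⟨hσD, hface, hdim⟩ := PureFan.mem_star.1 hσ
  obtain ⟨K, L, hKL, rfl⟩ := exists_adjacent_of_coneDim (hD.2 σ hσD) hdim
  have hIσ : splitVector n I ∈ cone₂ K L := hface.le (PointedCone.subset_hull rfl)
  obtain ⟨α, β, hα, hβ, h⟩ := PointedCone.mem_hull_pair.1 hIσ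
  have hsame : ∀ {M : Finset (Fin n)} {c : ℝ}, 0 ≤ c → splitVector n I = c • splitVector n M →
      SameSplit I M := fun {M c} hc0 hM =>
    sameSplit_of_eq_smul_add_smul (I := ∅) (α := 0) hI (compatible_empty_right I)
      hI.not_sameSplit_empty hc0 (by rw [zero_smul, zero_add, hM])
  have hres : ∀ {M N : Finset (Fin n)}, Adjacent M N → SameSplit I M →
      Adjacent I N ∧ cone₂ M N = cone₂ I N := fun {M N} hMN hIM =>
    ⟨⟨hI, hMN.right, (hMN.symm.compatible.congr_right hIM.symm).symm,
      fun hs => hMN.ne (hIM.symm.trans hs)⟩, by rw [cone₂, cone₂, hIM.splitVector_eq]⟩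
  rcases hα.eq_or_lt with rfl | hα
  · obtain ⟨h1, h2⟩ := hres hKL.symm (hsame hβ (by simpa using h))
    exact ⟨K, h1, by rw [cone₂_comm, h2]⟩
  rcases hβ.eq_or_lt with rfl | hβ
  · obtain ⟨h1, h2⟩ := hres hKL (hsame hα.le (by simpa using h))
    exact ⟨L, h1, h2⟩
  -- In the remaining case $v_I$ is interior to the cone, so the face `ray I` contains both
  -- generators, which are independent.
  exfalso
  have hKσ : splitVector n K ∈ cone₂ K L := PointedCone.subset_hull (by simp)
  have hLσ : splitVector n L ∈ cone₂ K L := PointedCone.subset_hull (by simp)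
  have hmem : α • splitVector n K + β • splitVector n L ∈ ray I :=
    h ▸ PointedCone.subset_hull rfl
  have hK := hface.mem_of_smul_add_smul_mem_left hKσ hLσ hα hβ hmem
  have hL := hface.mem_of_smul_add_smul_mem_right hKσ hLσ hα hβ hmem
  obtain ⟨c, hc, hK⟩ := PointedCone.mem_hull_singleton.1 hK
  obtain ⟨d, hd, hL⟩ := PointedCone.mem_hull_singleton.1 hL
  have hc0 : c ≠ 0 := by
    rintro rfl
    exact hKL.left.splitVector_ne_zero (by simpa using hK)
  refine hKL.notMem_span (Submodule.mem_span_singleton.2 ⟨d * c⁻¹, ?_⟩)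
  rw [hK, smul_smul, mul_assoc, inv_mul_cancel₀ hc0, mul_one, hL]

theorem exists_int_of_mem_lattice {a b c d : Fin n} {f : Ambient n →ₗ[ℝ] ℝ}
    (hf : ∀ I, f (splitVector n I) = quartet I a b c d) {v : Ambient n} (hv : v ∈ lattice n) :
    ∃ m : ℤ, f v = 2 * m := by
  induction hv using Submodule.span_induction with
  | mem v hv =>
    obtain ⟨I, -, rfl⟩ := hv
    obtain ⟨m, hm⟩ := even_quartet I a b c d
    exact ⟨m, by rw [hf, hm]; push_cast; rfl⟩
  | zero => exact ⟨0, by simp⟩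
  | add v w _ _ hv hw =>
    obtain ⟨m, hm⟩ := hv
    obtain ⟨k, hk⟩ := hw
    exact ⟨m + k, by rw [map_add, hm, hk]; push_cast; ring⟩
  | smul k v _ hv =>
    obtain ⟨m, hm⟩ := hv
    exact ⟨k * m, by rw [map_zsmul, hm, zsmul_eq_mul]; push_cast; ring⟩

theorem IsSplit.splitVector_mem_lattice {I : Finset (Fin n)} (hI : IsSplit n I) :
    splitVector n I ∈ lattice n :=
  Submodule.subset_span ⟨I, hI, rfl⟩

/-- The lattice normal of a two-dimensional cone is the vector of the second split. -/
theorem Adjacent.sub_splitVector_mem {I J : Finset (Fin n)} (h : Adjacent I J) {u : Ambient n}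
    (hu : IsLatticeNormal (lattice n) (cone₂ I J) (ray I) u) :
    ∃ r : ℝ, u = splitVector n J + r • splitVector n I := by
  obtain ⟨huΛ, ⟨x, hx, hux⟩, hgen⟩ := hu
  obtain ⟨α, β, -, hβ, rfl⟩ := PointedCone.mem_hull_pair.1 hx
  rw [coneSpan_ray] at hux hgen
  obtain ⟨s, hs⟩ := Submodule.mem_span_singleton.1 hux
  have hu : u = (α + s) • splitVector n I + β • splitVector n J := by
    rw [add_smul, hs]
    abel
  obtain ⟨m, hm⟩ := hgen _ h.right.splitVector_mem_lattice
    (mem_coneSpan (PointedCone.subset_hull (by simp)))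
  obtain ⟨r, hr⟩ := Submodule.mem_span_singleton.1 hm
  obtain ⟨a, b, c, d, hab, hac, hbd, hcd, h1, h2, -⟩ :=
    exists_quartet h.right h.symm.compatible h.symm.ne h.symm.ne
  obtain ⟨f, hf⟩ := exists_form_quartet hab hac hbd hcd
  have hfu : f u = 2 * β := by
    rw [hu, map_add, map_smul, map_smul, hf, hf, h1, h2]
    norm_num
    ring
  have hmβ : (m : ℝ) * β = 1 := by
    have := congrArg f hr
    rw [map_sub, map_smul, map_zsmul, hfu, hf, hf, h1, h2, zsmul_eq_mul] at this
    norm_num at this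
    linarith
  -- Quartet forms are even on the lattice and `f u = 2 * β`, so `β` is an integer; being
  -- non-negative with `m * β = 1`, it equals 1.
  obtain ⟨k, hk⟩ := exists_int_of_mem_lattice hf huΛ
  have hkβ : (k : ℝ) = β := by linarith
  rw [← hkβ] at hmβ hβ
  have hmk : m * k = 1 := by exact_mod_cast hmβ
  have hk0 : 0 ≤ k := by exact_mod_cast hβ
  have hk1 : k = 1 := by
    rcases Int.isUnit_iff.1 (IsUnit.of_mul_eq_one_right m hmk) with h | h <;> omega
  refine ⟨α + s, ?_⟩
  rw [hu, ← hkβ, hk1, Int.cast_one, one_smul, add_comm]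

open Classical in
/-- The weight of the cone spanned by two splits, zero if it does not belong to the cycle. -/
noncomputable def edgeWeight (D : TropicalCycle (lattice n) 2) (I J : Finset (Fin n)) : ℝ :=
  if cone₂ I J ∈ D.cones then (D.weight (cone₂ I J) : ℝ) else 0

theorem edgeWeight_comm (I J : Finset (Fin n)) : edgeWeight D I J = edgeWeight D J I := by
  rw [edgeWeight, edgeWeight, cone₂_comm]

theorem mem_cones_of_edgeWeight_ne_zero {I J : Finset (Fin n)} (h : edgeWeight D I J ≠ 0) :
    cone₂ I J ∈ D.cones := by
  by_contra hcon
  exact h (if_neg hcon)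

theorem Adjacent.edgeWeight_ne_zero {I J : Finset (Fin n)} (h : Adjacent I J)
    (hmem : cone₂ I J ∈ D.cones) : edgeWeight D I J ≠ 0 := by
  rw [edgeWeight, if_pos hmem]
  exact_mod_cast D.weight_ne_zero _ hmem h.coneDim_cone₂

theorem edgeWeight_congr {I J K : Finset (Fin n)} (h : SameSplit J K) :
    edgeWeight D I J = edgeWeight D I K := by
  rw [edgeWeight, edgeWeight, cone₂, cone₂, h.splitVector_eq]

open Classical in
/-- The balancing condition at a ray, evaluated on a quartet. -/
theorem IsDivisor.sum_edgeWeight_eq_zero (hD : IsDivisor n D) {I : Finset (Fin n)}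
    (hI : IsSplit n I) (hray : ray I ∈ D.cones) {a b c d : Fin n} (hab : a ≠ b) (hac : a ≠ c)
    (hbd : b ≠ d) (hcd : c ≠ d) (hI0 : quartet I a b c d = 0) {ι : Type*} [Fintype ι]
    (X : ι → Finset (Fin n)) (hX : ∀ i, Adjacent I (X i)) (e : ι → ℤ)
    (hquartet : ∀ J, Compatible I J →
      quartet J a b c d = ∑ i, if SameSplit J (X i) then e i else 0) :
    ∑ i, (e i : ℝ) * edgeWeight D I (X i) = 0 := by
  obtain ⟨f, hf⟩ := exists_form_quartet hab hac hbd hcd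
  obtain ⟨u, hu, hsum⟩ := D.balanced (ray I) hray (by rw [hI.coneDim_ray])
  -- The normal is $v_J$ up to a multiple of $v_I$, and `f` kills $v_I$; so `f` reads off the
  -- quartet of `J`.
  have hterm : ∀ σ ∈ D.star (ray I), f (u σ) = ∑ i, if σ = cone₂ I (X i) then (e i : ℝ) else 0 := by
    intro σ hσ
    obtain ⟨J, hJ, rfl⟩ := hD.exists_adjacent_of_mem_star hI hσ
    obtain ⟨r, hr⟩ := hJ.sub_splitVector_mem (hu _ hσ)
    rw [hr, map_add, map_smul, hf, hf, hI0, Int.cast_zero, smul_zero, add_zero,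
      hquartet J hJ.compatible]
    push_cast
    refine Finset.sum_congr rfl fun i _ => ?_
    have hiff : SameSplit J (X i) ↔ cone₂ I J = cone₂ I (X i) :=
      ⟨fun h => by rw [cone₂, cone₂, h.splitVector_eq], fun h => hJ.sameSplit_of_cone₂_eq h⟩
    simp only [hiff]
  rw [coneSpan_ray] at hsum
  obtain ⟨r, hr⟩ := Submodule.mem_span_singleton.1 hsum
  have h0 := congrArg f hr
  rw [map_smul, hf, hI0, Int.cast_zero, smul_zero, map_sum] at h0
  rw [h0]
  have hexp : ∀ σ ∈ D.star (ray I), f ((D.weight σ : ℝ) • u σ) =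
      ∑ i, if σ = cone₂ I (X i) then (e i : ℝ) * D.weight σ else 0 := by
    intro σ hσ
    rw [map_smul, hterm σ hσ, smul_eq_mul, Finset.mul_sum]
    refine Finset.sum_congr rfl fun i _ => ?_
    split_ifs <;> ring
  rw [Finset.sum_congr rfl hexp, Finset.sum_comm]
  refine Finset.sum_congr rfl fun i _ => ?_
  rw [Finset.sum_ite_eq' (D.star (ray I)) (cone₂ I (X i)) fun σ => (e i : ℝ) * D.weight σ]
  have hmem : cone₂ I (X i) ∈ D.star (ray I) ↔ cone₂ I (X i) ∈ D.cones :=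
    ⟨fun h => (PureFan.mem_star.1 h).1,
      fun h => PureFan.mem_star.2 ⟨h, (hX i).isFaceOf, (hX i).coneDim_cone₂⟩⟩
  simp only [hmem, edgeWeight, mul_ite, mul_zero]

theorem Adjacent.ray_mem {I J : Finset (Fin n)} (h : Adjacent I J) (hmem : cone₂ I J ∈ D.cones) :
    ray I ∈ D.cones :=
  D.face_mem _ hmem _ h.isFaceOf

theorem IsDivisor.exists_adjacent_of_ray_mem (hD : IsDivisor n D) {I : Finset (Fin n)}
    (hI : IsSplit n I) (hray : ray I ∈ D.cones) :
    ∃ J, Adjacent I J ∧ cone₂ I J ∈ D.cones := by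
  obtain ⟨σ, hσ, hle, hdim⟩ := D.pure _ hray
  have hmem : splitVector n I ∈ ray I := PointedCone.subset_hull rfl
  have hface : (ray I).IsFaceOf σ :=
    D.isFaceOf_of_mem hray hσ hmem (hle hmem) (coneSpan_ray I).le
  obtain ⟨J, hJ, rfl⟩ := hD.exists_adjacent_of_mem_star hI (PureFan.mem_star.2 ⟨hσ, hface, hdim⟩)
  exact ⟨J, hJ, hσ⟩

end Surfaces

end TropicalM0

/-! ### Quartets around a ray for six markings -/

namespace TropicalM0

theorem exists_notMem_of_nodup {L : List (Fin 6)} (hL : L.Nodup) (hlen : L.length < 6) :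
    ∃ x, x ∉ L := by
  by_contra! h
  have h1 : L.toFinset = Finset.univ := Finset.eq_univ_iff_forall.2 fun x => by simp [h x]
  have h2 := List.toFinset_card_of_nodup hL
  rw [h1, Finset.card_univ, Fintype.card_fin] at h2
  omega

theorem forall_iff_of_nodup {i j k l m n : Fin 6} (h : [i, j, k, l, m, n].Nodup)
    (P : Fin 6 → Prop) : (∀ x, P x) ↔ P i ∧ P j ∧ P k ∧ P l ∧ P m ∧ P n := by
  refine ⟨fun hP => ⟨hP i, hP j, hP k, hP l, hP m, hP n⟩, ?_⟩
  rintro ⟨hi, hj, hk, hl, hm, hn⟩ x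
  have hx : x ∈ [i, j, k, l, m, n].toFinset := by
    have huniv : [i, j, k, l, m, n].toFinset = Finset.univ :=
      Finset.eq_univ_of_card _ (by rw [List.toFinset_card_of_nodup h]; simp)
    exact huniv ▸ Finset.mem_univ x
  simp only [List.mem_toFinset, List.mem_cons, List.not_mem_nil, or_false] at hx
  rcases hx with rfl | rfl | rfl | rfl | rfl | rfl <;> assumption

theorem compatible_iff_of_nodup {i j k l m n : Fin 6} (h : [i, j, k, l, m, n].Nodup)
    {I J : Finset (Fin 6)} (hIJ : Compatible I J) :
    ((i ∈ I → i ∈ J) ∧ (j ∈ I → j ∈ J) ∧ (k ∈ I → k ∈ J) ∧ (l ∈ I → l ∈ J) ∧ (m ∈ I → m ∈ J) ∧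
      (n ∈ I → n ∈ J)) ∨
    ((i ∈ J → i ∈ I) ∧ (j ∈ J → j ∈ I) ∧ (k ∈ J → k ∈ I) ∧ (l ∈ J → l ∈ I) ∧ (m ∈ J → m ∈ I) ∧
      (n ∈ J → n ∈ I)) ∨
    ((i ∈ I → i ∉ J) ∧ (j ∈ I → j ∉ J) ∧ (k ∈ I → k ∉ J) ∧ (l ∈ I → l ∉ J) ∧ (m ∈ I → m ∉ J) ∧
      (n ∈ I → n ∉ J)) ∨
    ((i ∈ I ∨ i ∈ J) ∧ (j ∈ I ∨ j ∈ J) ∧ (k ∈ I ∨ k ∈ J) ∧ (l ∈ I ∨ l ∈ J) ∧ (m ∈ I ∨ m ∈ J) ∧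
      (n ∈ I ∨ n ∈ J)) := by
  rcases hIJ with h' | h' | h' | h'
  · exact Or.inl ((forall_iff_of_nodup h fun x => x ∈ I → x ∈ J).1 fun x hx => h' hx)
  · exact Or.inr (Or.inl ((forall_iff_of_nodup h fun x => x ∈ J → x ∈ I).1 fun x hx => h' hx))
  · exact Or.inr (Or.inr (Or.inl ((forall_iff_of_nodup h fun x => x ∈ I → x ∉ J).1
      fun x hx => Finset.disjoint_left.1 h' hx)))
  · exact Or.inr (Or.inr (Or.inr ((forall_iff_of_nodup h fun x => x ∈ I ∨ x ∈ J).1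
      fun x => Finset.mem_union.1 (h' ▸ Finset.mem_univ x))))

theorem sameSplit_iff_of_nodup {i j k l m n : Fin 6} (h : [i, j, k, l, m, n].Nodup)
    {I J : Finset (Fin 6)} : SameSplit I J ↔
      ((i ∈ I ↔ i ∈ J) ∧ (j ∈ I ↔ j ∈ J) ∧ (k ∈ I ↔ k ∈ J) ∧ (l ∈ I ↔ l ∈ J) ∧ (m ∈ I ↔ m ∈ J) ∧
        (n ∈ I ↔ n ∈ J)) ∨
      ((i ∈ I ↔ i ∉ J) ∧ (j ∈ I ↔ j ∉ J) ∧ (k ∈ I ↔ k ∉ J) ∧ (l ∈ I ↔ l ∉ J) ∧ (m ∈ I ↔ m ∉ J) ∧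
        (n ∈ I ↔ n ∉ J)) := by
  rw [SameSplit, Finset.ext_iff, Finset.ext_iff, forall_iff_of_nodup h, forall_iff_of_nodup h]
  simp only [Finset.mem_compl]

-- A split compatible with $ij$ induces $ik|lm$ only as $ijk$ or $lm$, and $il|km$ only as $ijl$ or
-- $km$. Verified by cases on the membership of each marking in `J`.
set_option linter.unusedSimpArgs false in
open Classical in
theorem quartet_of_compatible_pair {i j k l m n : Fin 6} (h : [i, j, k, l, m, n].Nodup)
    {J : Finset (Fin 6)} (hJ : Compatible {i, j} J) :
    quartet J i k l m = ∑ x : Fin 4,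
      if SameSplit J (![{i, j, k}, {l, m}, {i, j, l}, {k, m}] x) then
        (![2, 2, -2, -2] : Fin 4 → ℤ) x else 0 := by
  have hc := compatible_iff_of_nodup h hJ
  rw [Fin.sum_univ_four]
  simp only [sameSplit_iff_of_nodup h]
  simp only [List.nodup_cons, List.mem_cons, List.not_mem_nil, or_false, not_or] at h
  obtain ⟨⟨h1, h2, h3, h4, h5⟩, ⟨h6, h7, h8, h9⟩, ⟨h10, h11, h12⟩, ⟨h13, h14⟩, h15, -⟩ := h
  simp only [Finset.mem_insert, Finset.mem_singleton, h1, h2, h3, h4, h5, h6, h7, h8, h9, h10,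
    h11, h12, h13, h14, h15, Ne.symm h1, Ne.symm h2, Ne.symm h3, Ne.symm h4, Ne.symm h5,
    Ne.symm h6, Ne.symm h7, Ne.symm h8, Ne.symm h9, Ne.symm h10, Ne.symm h11, Ne.symm h12,
    Ne.symm h13, Ne.symm h14, Ne.symm h15, Matrix.cons_val, quartet, sep, or_false, or_true,
    false_or, true_or, false_implies, true_implies, implies_true, true_and, and_true, not_true,
    not_false_iff, iff_true, iff_false] at hc ⊢
  clear h1 h2 h3 h4 h5 h6 h7 h8 h9 h10 h11 h12 h13 h14 h15 hJ
  by_cases hi : i ∈ J <;> by_cases hj : j ∈ J <;> by_cases hk : k ∈ J <;>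
    by_cases hl : l ∈ J <;> by_cases hm : m ∈ J <;> by_cases hn : n ∈ J <;>
    simp_all only [if_true, if_false, iff_self, iff_true, iff_false, not_true, not_false_iff,
      and_true, and_false, true_and, false_and, or_true, or_false, true_or, false_or, and_self,
      or_self, true_implies, false_implies, implies_true] <;> rfl

-- A split compatible with $ijk$ induces $ij|kl$ only as $ij$, and $ik|jl$ only as $ik$.
set_option linter.unusedSimpArgs false in
open Classical in
theorem quartet_of_compatible_triple {i j k l m n : Fin 6} (h : [i, j, k, l, m, n].Nodup)
    {J : Finset (Fin 6)} (hJ : Compatible {i, j, k} J) :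
    quartet J i j k l = ∑ x : Fin 2,
      if SameSplit J (![{i, j}, {i, k}] x) then (![2, -2] : Fin 2 → ℤ) x else 0 := by
  have hc := compatible_iff_of_nodup h hJ
  rw [Fin.sum_univ_two]
  simp only [sameSplit_iff_of_nodup h]
  simp only [List.nodup_cons, List.mem_cons, List.not_mem_nil, or_false, not_or] at h
  obtain ⟨⟨h1, h2, h3, h4, h5⟩, ⟨h6, h7, h8, h9⟩, ⟨h10, h11, h12⟩, ⟨h13, h14⟩, h15, -⟩ := h
  simp only [Finset.mem_insert, Finset.mem_singleton, h1, h2, h3, h4, h5, h6, h7, h8, h9, h10,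
    h11, h12, h13, h14, h15, Ne.symm h1, Ne.symm h2, Ne.symm h3, Ne.symm h4, Ne.symm h5,
    Ne.symm h6, Ne.symm h7, Ne.symm h8, Ne.symm h9, Ne.symm h10, Ne.symm h11, Ne.symm h12,
    Ne.symm h13, Ne.symm h14, Ne.symm h15, Matrix.cons_val, quartet, sep, or_false, or_true,
    false_or, true_or, false_implies, true_implies, implies_true, true_and, and_true, not_true,
    not_false_iff, iff_true, iff_false] at hc ⊢
  clear h1 h2 h3 h4 h5 h6 h7 h8 h9 h10 h11 h12 h13 h14 h15 hJ
  by_cases hi : i ∈ J <;> by_cases hj : j ∈ J <;> by_cases hk : k ∈ J <;>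
    by_cases hl : l ∈ J <;> by_cases hm : m ∈ J <;> by_cases hn : n ∈ J <;>
    simp_all only [if_true, if_false, iff_self, iff_true, iff_false, not_true, not_false_iff,
      and_true, and_false, true_and, false_and, or_true, or_false, true_or, false_or, and_self,
      or_self, true_implies, false_implies, implies_true] <;> rfl

end TropicalM0

/-! ### Divisors in $\mathcal M_{0,6}$ and their graphs of pairs -/

namespace TropicalM0

section Six

theorem isSplit_pair {i j : Fin 6} (hij : i ≠ j) : IsSplit 6 {i, j} := by
  rw [IsSplit, Finset.card_pair hij]
  norm_num

theorem isSplit_triple {i j k : Fin 6} (hij : i ≠ j) (hik : i ≠ k) (hjk : j ≠ k) :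
    IsSplit 6 {i, j, k} := by
  rw [IsSplit, Finset.card_eq_three.2 ⟨i, j, k, hij, hik, hjk, rfl⟩]
  norm_num

theorem SameSplit.card_eq {I J : Finset (Fin 6)} (h : SameSplit I J) :
    I.card = J.card ∨ I.card + J.card = 6 := by
  rcases h with rfl | rfl
  · exact Or.inl rfl
  · exact Or.inr (by rw [Finset.card_compl_add_card, Fintype.card_fin])

theorem adjacent_pair_pair {i j k l : Fin 6} (hij : i ≠ j) (hkl : k ≠ l) (hki : k ≠ i)
    (hkj : k ≠ j) (hli : l ≠ i) (hlj : l ≠ j) : Adjacent {i, j} ({k, l} : Finset (Fin 6)) := by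
  refine ⟨isSplit_pair hij, isSplit_pair hkl, Or.inr (Or.inr (Or.inl ?_)), ?_⟩
  · simp [hki, hkj, hli, hlj]
  · rintro (h | h)
    · have : i ∈ ({k, l} : Finset (Fin 6)) := h ▸ Finset.mem_insert_self i _
      simp [hki.symm, hli.symm] at this
    · have := congrArg Finset.card h
      rw [Finset.card_compl, Finset.card_pair hij, Finset.card_pair hkl] at this
      simp at this

theorem adjacent_pair_triple {i j k : Fin 6} (hij : i ≠ j) (hki : k ≠ i) (hkj : k ≠ j) :
    Adjacent {i, j} ({i, j, k} : Finset (Fin 6)) := by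
  refine ⟨isSplit_pair hij, isSplit_triple hij hki.symm hkj.symm, Or.inl ?_, fun h => ?_⟩
  · intro x
    simp only [Finset.mem_insert, Finset.mem_singleton]
    tauto
  · have := h.card_eq
    rw [Finset.card_pair hij,
      Finset.card_eq_three.2 ⟨i, j, k, hij, hki.symm, hkj.symm, rfl⟩] at this
    omega

/-- Up to complement, `J` contains `i` and `j`. With three elements it is a triple $ijk$; with four,
its complement is a disjoint pair. -/
theorem Adjacent.pair_cases {i j : Fin 6} {J : Finset (Fin 6)} (h : Adjacent {i, j} J)
    (hij : i ≠ j) :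
    (∃ k, k ≠ i ∧ k ≠ j ∧ SameSplit J {i, j, k}) ∨
      ∃ k l, k ≠ l ∧ k ≠ i ∧ k ≠ j ∧ l ≠ i ∧ l ≠ j ∧ SameSplit J {k, l} := by
  have hsplit := h.right
  have key : ∀ A : Finset (Fin 6), SameSplit J A → {i, j} ⊆ A →
      (∃ k, k ≠ i ∧ k ≠ j ∧ SameSplit J {i, j, k}) ∨
        ∃ k l, k ≠ l ∧ k ≠ i ∧ k ≠ j ∧ l ≠ i ∧ l ≠ j ∧ SameSplit J {k, l} := by
    intro A hJA hsub
    have hcard := hJA.card_eq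
    have hsdiff := Finset.card_sdiff_add_card_eq_card hsub
    have hcompl := Finset.card_compl_add_card A
    rw [Finset.card_pair hij] at hsdiff
    rw [Fintype.card_fin] at hcompl
    have hA : A.card = 2 ∨ A.card = 3 ∨ A.card = 4 := by
      have h1 := hsplit.1
      have h2 := hsplit.2
      omega
    rcases hA with hA | hA | hA
    · refine absurd ?_ h.ne
      rw [Finset.eq_of_subset_of_card_le hsub (by rw [hA, Finset.card_pair hij])]
      exact hJA.symm
    · left
      obtain ⟨k, hk⟩ := Finset.card_eq_one.1 (show (A \ {i, j}).card = 1 by omega)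
      have hkm : k ∈ A \ {i, j} := hk ▸ Finset.mem_singleton_self k
      simp only [Finset.mem_sdiff, Finset.mem_insert, Finset.mem_singleton, not_or] at hkm
      refine ⟨k, hkm.2.1, hkm.2.2, ?_⟩
      have hAeq : A = {i, j, k} := by
        rw [← Finset.sdiff_union_of_subset hsub, hk]
        ext x
        simp only [Finset.mem_union, Finset.mem_insert, Finset.mem_singleton]
        tauto
      rwa [← hAeq]
    · right
      obtain ⟨k, l, hkl, hkl'⟩ := Finset.card_eq_two.1 (show (Aᶜ).card = 2 by omega)
      have hk : k ∉ A := Finset.mem_compl.1 (hkl' ▸ Finset.mem_insert_self k _)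
      have hl : l ∉ A := Finset.mem_compl.1
        (hkl' ▸ Finset.mem_insert_of_mem (Finset.mem_singleton_self l))
      have hi : i ∈ A := hsub (by simp)
      have hj : j ∈ A := hsub (by simp)
      refine ⟨k, l, hkl, ?_, ?_, ?_, ?_, ?_⟩
      · rintro rfl
        exact hk hi
      · rintro rfl
        exact hk hj
      · rintro rfl
        exact hl hi
      · rintro rfl
        exact hl hj
      · rw [← hkl']
        exact hJA.trans (Or.inr (compl_compl A).symm)
  rcases h.compatible with hc | hc | hc | hc
  · exact key J (Or.inl rfl) hc
  · refine absurd (Or.inl ?_) h.ne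
    exact (Finset.eq_of_subset_of_card_le hc (by
      rw [Finset.card_pair hij]
      exact hsplit.1)).symm
  · exact key Jᶜ (Or.inr (compl_compl J).symm) fun x hx =>
      Finset.mem_compl.2 (Finset.disjoint_left.1 hc hx)
  · refine absurd (Or.inr ?_) h.ne
    have hsub : Jᶜ ⊆ {i, j} := fun x hx =>
      (Finset.mem_union.1 (hc ▸ Finset.mem_univ x)).resolve_right (Finset.mem_compl.1 hx)
    refine (Finset.eq_of_subset_of_card_le hsub ?_).symm
    have h1 := Finset.card_compl_add_card J
    have h2 := hsplit.2
    rw [Fintype.card_fin] at h1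
    rw [Finset.card_pair hij]
    omega

/-- A two-dimensional cone of `M_{0,6}` has a ray given by a pair of markings. -/
theorem Adjacent.exists_pair {I J : Finset (Fin 6)} (h : Adjacent I J) :
    ∃ i j, i ≠ j ∧ (SameSplit I {i, j} ∨ SameSplit J {i, j}) := by
  have key : ∀ A : Finset (Fin 6), IsSplit 6 A → A.card ≠ 3 →
      ∃ i j, i ≠ j ∧ SameSplit A {i, j} := by
    intro A hA h3
    have h1 := hA.1
    have h2 := hA.2
    have h4 := Finset.card_compl_add_card A
    rw [Fintype.card_fin] at h4
    rcases (show A.card = 2 ∨ (Aᶜ).card = 2 by omega) with h5 | h5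
    · obtain ⟨i, j, hij, hA⟩ := Finset.card_eq_two.1 h5
      exact ⟨i, j, hij, Or.inl hA⟩
    · obtain ⟨i, j, hij, hA⟩ := Finset.card_eq_two.1 h5
      exact ⟨i, j, hij, Or.inr (by rw [← hA, compl_compl])⟩
  -- Two compatible triples define the same split, since inclusions between sets of three elements
  -- are equalities; so one of the splits is a pair.
  by_cases hI : I.card = 3
  · by_cases hJ : J.card = 3
    · exfalso
      have h4 := Finset.card_compl_add_card J
      rw [Fintype.card_fin] at h4
      rcases h.compatible with hc | hc | hc | hc
      · exact h.ne (Or.inl (Finset.eq_of_subset_of_card_le hc (by omega)))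
      · exact h.ne (Or.inl (Finset.eq_of_subset_of_card_le hc (by omega)).symm)
      · exact h.ne (Or.inr (Finset.eq_of_subset_of_card_le
          (fun x hx => Finset.mem_compl.2 (Finset.disjoint_left.1 hc hx)) (by omega)))
      · refine h.ne (Or.inr (Finset.eq_of_subset_of_card_le (fun x hx => ?_) (by omega)).symm)
        exact (Finset.mem_union.1 (hc ▸ Finset.mem_univ x)).resolve_right (Finset.mem_compl.1 hx)
    · obtain ⟨i, j, hij, hs⟩ := key J h.right hJ
      exact ⟨i, j, hij, Or.inr hs⟩
  · obtain ⟨i, j, hij, hs⟩ := key I h.left hI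
    exact ⟨i, j, hij, Or.inl hs⟩

variable {D : TropicalCycle (lattice 6) 2}

theorem IsDivisor.pair_relation (hD : IsDivisor 6 D) {i j k l m : Fin 6}
    (h : [i, j, k, l, m].Nodup) (hray : ray {i, j} ∈ D.cones) :
    edgeWeight D {i, j} {i, j, k} + edgeWeight D {i, j} {l, m} =
      edgeWeight D {i, j} {i, j, l} + edgeWeight D {i, j} {k, m} := by
  obtain ⟨n, hn⟩ := exists_notMem_of_nodup h (by simp)
  have h6 : [i, j, k, l, m, n].Nodup := by
    have := (List.nodup_append_comm (l₁ := [n]) (l₂ := [i, j, k, l, m])).1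
      (List.nodup_cons.2 ⟨hn, h⟩)
    exact this
  simp only [List.nodup_cons, List.mem_cons, List.not_mem_nil, or_false, not_or] at h
  obtain ⟨⟨hij, hik, hil, him⟩, ⟨hjk, hjl, hjm⟩, ⟨hkl, hkm⟩, hlm, -⟩ := h
  have hsum := hD.sum_edgeWeight_eq_zero (isSplit_pair hij) hray hik hil hkm hlm
    (by simp [quartet, sep, Ne.symm hik, Ne.symm hjk, Ne.symm hil, Ne.symm hjl, Ne.symm him,
      Ne.symm hjm])
    ![{i, j, k}, {l, m}, {i, j, l}, {k, m}]
    (by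
      intro x
      fin_cases x
      · exact adjacent_pair_triple hij (Ne.symm hik) (Ne.symm hjk)
      · exact adjacent_pair_pair hij hlm (Ne.symm hil) (Ne.symm hjl) (Ne.symm him) (Ne.symm hjm)
      · exact adjacent_pair_triple hij (Ne.symm hil) (Ne.symm hjl)
      · exact adjacent_pair_pair hij hkm (Ne.symm hik) (Ne.symm hjk) (Ne.symm him) (Ne.symm hjm))
    ![2, 2, -2, -2] fun J hJ => quartet_of_compatible_pair h6 hJ
  rw [Fin.sum_univ_four] at hsum
  simp only [Matrix.cons_val] at hsum
  push_cast at hsum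
  linarith

theorem IsDivisor.triple_relation (hD : IsDivisor 6 D) {i j k : Fin 6} (hij : i ≠ j)
    (hik : i ≠ k) (hjk : j ≠ k) (hray : ray {i, j, k} ∈ D.cones) :
    edgeWeight D {i, j, k} {i, j} = edgeWeight D {i, j, k} {i, k} := by
  have h3 : [i, j, k].Nodup := by simp [hij, hik, hjk]
  obtain ⟨n, hn⟩ := exists_notMem_of_nodup h3 (by simp)
  have h4 := List.nodup_cons.2 ⟨hn, h3⟩
  obtain ⟨m, hm⟩ := exists_notMem_of_nodup h4 (by simp)
  have h5 := List.nodup_cons.2 ⟨hm, h4⟩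
  obtain ⟨l, hl⟩ := exists_notMem_of_nodup h5 (by simp)
  have h6 : [i, j, k, l, m, n].Nodup :=
    (List.nodup_append_comm (l₁ := [l, m, n]) (l₂ := [i, j, k])).1 (List.nodup_cons.2 ⟨hl, h5⟩)
  simp only [List.mem_cons, List.not_mem_nil, or_false, not_or] at hl
  obtain ⟨-, -, hli, hlj, hlk⟩ := hl
  have hadj : ∀ {a b c : Fin 6}, a ≠ b → c ≠ a → c ≠ b → ({a, b, c} : Finset (Fin 6)) = {i, j, k} →
      Adjacent ({i, j, k} : Finset (Fin 6)) {a, b} := fun hab hca hcb he =>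
    he ▸ (adjacent_pair_triple hab hca hcb).symm
  have hsum := hD.sum_edgeWeight_eq_zero (isSplit_triple hij hik hjk) hray hij hik
    (Ne.symm hlj) (Ne.symm hlk)
    (by simp [quartet, sep, hli, hlj, hlk])
    ![{i, j}, {i, k}]
    (by
      intro x
      fin_cases x
      · exact hadj hij (Ne.symm hik) (Ne.symm hjk) rfl
      · exact hadj hik (Ne.symm hij) hjk (by rw [Finset.pair_comm k j]))
    ![2, -2] fun J hJ => quartet_of_compatible_triple h6 hJ
  rw [Fin.sum_univ_two] at hsum
  simp only [Matrix.cons_val] at hsum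
  push_cast at hsum
  linarith

/-- `pair_relation` says that `g k l`, the weight towards $v_{kl}$ minus the two triple weights,
does not change when one index is replaced. Any two pairs are linked by such replacements. -/
theorem IsDivisor.exists_pair_constant (hD : IsDivisor 6 D) {i j : Fin 6} (hij : i ≠ j)
    (hray : ray {i, j} ∈ D.cones) :
    ∃ s : ℝ, ∀ k l, k ≠ l → k ≠ i → k ≠ j → l ≠ i → l ≠ j →
      edgeWeight D {i, j} {k, l} =
        s + edgeWeight D {i, j} {i, j, k} + edgeWeight D {i, j} {i, j, l} := by
  set t := fun k => edgeWeight D {i, j} {i, j, k} with ht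
  set g := fun k l => edgeWeight D {i, j} {k, l} - t k - t l with hg
  have hcomm : ∀ k l, g k l = g l k := by
    intro k l
    simp only [hg]
    rw [Finset.pair_comm k l]
    ring
  have hrel : ∀ k l m, k ≠ m → l ≠ m → k ≠ i → k ≠ j → l ≠ i → l ≠ j → m ≠ i → m ≠ j →
      g l m = g k m := by
    intro k l m hkm hlm hki hkj hli hlj hmi hmj
    by_cases hkl : k = l
    · rw [hkl]
    have h5 : [i, j, k, l, m].Nodup := by
      simp [hij, hki.symm, hkj.symm, hli.symm, hlj.symm, hmi.symm, hmj.symm, hkl, hkm, hlm]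
    have := hD.pair_relation h5 hray
    simp only [hg, ht]
    linarith
  have h2 : [i, j].Nodup := by simp [hij]
  obtain ⟨a, ha⟩ := exists_notMem_of_nodup h2 (by simp)
  obtain ⟨b, hb⟩ := exists_notMem_of_nodup (List.nodup_cons.2 ⟨ha, h2⟩) (by simp)
  simp only [List.mem_cons, List.not_mem_nil, or_false, not_or] at ha hb
  refine ⟨g a b, fun k l hkl hki hkj hli hlj => ?_⟩
  have hgoal : g k l = g a b := by
    by_cases hla : l = a
    · rw [hla, hrel b k a hb.1 (hla ▸ hkl) hb.2.1 hb.2.2 hki hkj ha.1 ha.2, hcomm]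
    · rw [hrel a k l (Ne.symm hla) hkl ha.1 ha.2 hki hkj hli hlj, hcomm,
        hrel b l a hb.1 hla hb.2.1 hb.2.2 hli hlj ha.1 ha.2, hcomm]
  rw [← hgoal]
  simp only [hg, ht]
  ring

/-- The pairs of markings among the rays of a divisor form a saturated graph, even if only the rays
with a property that is invariant under adjacency are considered. -/
theorem IsDivisor.isSaturated (hD : IsDivisor 6 D) (P : Ambient 6 → Prop)
    (hP : ∀ I J, Adjacent I J → cone₂ I J ∈ D.cones → P (splitVector 6 I) → P (splitVector 6 J)) :
    SixGraph.IsSaturated fun i j =>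
      i ≠ j ∧ ray {i, j} ∈ D.cones ∧ P (splitVector 6 {i, j}) where
  symm := by
    rintro i j ⟨h1, h2, h3⟩
    rw [Finset.pair_comm] at h2 h3
    exact ⟨h1.symm, h2, h3⟩
  exists_apex := by
    rintro i j hij ⟨-, hray, hPij⟩
    have hstep : ∀ {I J : Finset (Fin 6)}, Adjacent I J → edgeWeight D I J ≠ 0 →
        P (splitVector 6 I) → ray J ∈ D.cones ∧ P (splitVector 6 J) := by
      intro I J hIJ hw hPI
      have hmem := mem_cones_of_edgeWeight_ne_zero hw
      exact ⟨hIJ.symm.ray_mem (cone₂_comm I J ▸ hmem), hP I J hIJ hmem hPI⟩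
    -- The three weights at $v_{ijk}$ agree, so a non-zero weight towards $v_{ij}$ gives cones
    -- towards $v_{ik}$ and $v_{jk}$ too.
    have htriangle : ∀ k, k ≠ i → k ≠ j → edgeWeight D {i, j} {i, j, k} ≠ 0 →
        (i ≠ k ∧ ray {i, k} ∈ D.cones ∧ P (splitVector 6 {i, k})) ∧
          j ≠ k ∧ ray {j, k} ∈ D.cones ∧ P (splitVector 6 {j, k}) := by
      intro k hki hkj hw
      obtain ⟨hray3, hP3⟩ := hstep (adjacent_pair_triple hij hki hkj) hw hPij
      rw [edgeWeight_comm] at hw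
      have he1 : ({i, k, j} : Finset (Fin 6)) = {i, j, k} := by rw [Finset.pair_comm]
      have he2 : ({j, i, k} : Finset (Fin 6)) = {i, j, k} := Finset.insert_comm j i {k}
      have he3 : ({j, k, i} : Finset (Fin 6)) = {i, j, k} := by rw [Finset.pair_comm, he2]
      have hw1 := hD.triple_relation hij hki.symm hkj.symm hray3
      have hw2 := hD.triple_relation hij.symm hkj.symm hki.symm (he2.symm ▸ hray3)
      rw [he2, Finset.pair_comm j i] at hw2
      have hadj1 : Adjacent ({i, j, k} : Finset (Fin 6)) {i, k} :=
        he1 ▸ (adjacent_pair_triple hki.symm hij.symm hkj.symm).symm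
      have hadj2 : Adjacent ({i, j, k} : Finset (Fin 6)) {j, k} :=
        he3 ▸ (adjacent_pair_triple hkj.symm hij hki.symm).symm
      exact ⟨⟨hki.symm, hstep hadj1 (hw1 ▸ hw) hP3⟩, hkj.symm, hstep hadj2 (hw2 ▸ hw) hP3⟩
    have hpair : ∀ k l, k ≠ l → k ≠ i → k ≠ j → l ≠ i → l ≠ j → edgeWeight D {i, j} {k, l} ≠ 0 →
        k ≠ l ∧ ray {k, l} ∈ D.cones ∧ P (splitVector 6 {k, l}) :=
      fun k l hkl hki hkj hli hlj hw =>
        ⟨hkl, hstep (adjacent_pair_pair hij hkl hki hkj hli hlj) hw hPij⟩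
    obtain ⟨s, hs⟩ := hD.exists_pair_constant hij hray
    refine ⟨fun k => edgeWeight D {i, j} {i, j, k} ≠ 0, htriangle, ?_⟩
    -- For `s = 0` the weight towards $v_{kl}$ is $t_k+t_l$, non-zero when exactly one of `k`, `l`
    -- is in `T`; since some cone of `D` contains the ray, `T` is non-empty. For `s ≠ 0` the weight
    -- is `s` when both are outside `T`.
    by_cases hs0 : s = 0
    · right
      refine ⟨?_, fun k l hki hkj hli hlj hk hl => ?_⟩
      · obtain ⟨J, hJ, hmem⟩ := hD.exists_adjacent_of_ray_mem (isSplit_pair hij) hray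
        have hw := hJ.edgeWeight_ne_zero hmem
        rcases hJ.pair_cases hij with ⟨k, hki, hkj, hJk⟩ | ⟨k, l, hkl, hki, hkj, hli, hlj, hJkl⟩
        · rw [edgeWeight_congr hJk] at hw
          exact ⟨k, hki, hkj, hw⟩
        · rw [edgeWeight_congr hJkl, hs k l hkl hki hkj hli hlj, hs0, zero_add] at hw
          by_cases hk : edgeWeight D {i, j} {i, j, k} = 0
          · exact ⟨l, hli, hlj, by rwa [hk, zero_add] at hw⟩
          · exact ⟨k, hki, hkj, hk⟩
      · have hkl : k ≠ l := by
          rintro rfl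
          exact hl hk
        refine hpair k l hkl hki hkj hli hlj ?_
        rw [hs k l hkl hki hkj hli hlj, hs0, not_not.1 hl, zero_add, add_zero]
        exact hk
    · left
      intro k l hki hkj hli hlj hkl hk hl
      refine hpair k l hkl hki hkj hli hlj ?_
      rw [hs k l hkl hki hkj hli hlj, not_not.1 hk, not_not.1 hl, add_zero, add_zero]
      exact hs0

end Six

end TropicalM0

/-! ### The proposition -/

theorem mainTheorem4 (D : TropicalCycle (TropicalM0.lattice 6) 2)
    (hD : TropicalM0.IsDivisor 6 D) (hloc : D.IsLocallyIrreducible) :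
    D.IsIrreducible := by
  rintro ⟨Y, hYD⟩
  have hsub : Y.support ⊆ D.support := hYD.subset
  -- A ray in $|Y|$ forces `Y` into the interior of each adjacent cone, and hence to contain that
  -- cone.
  have hfill : ∀ I J, TropicalM0.Adjacent I J → TropicalM0.cone₂ I J ∈ D.cones →
      TropicalM0.splitVector 6 I ∈ Y.support →
      ∀ x ∈ TropicalM0.cone₂ I J, x ∈ Y.support := by
    intro I J hIJ hmem hI x hx
    have h0 := hIJ.left.splitVector_ne_zero
    have hstar : TropicalM0.cone₂ I J ∈ D.star (TropicalM0.ray I) :=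
      PureFan.mem_star.2 ⟨hmem, hIJ.isFaceOf, hIJ.coneDim_cone₂⟩
    obtain ⟨y, hy, hys, hyY⟩ :=
      hloc.exists_mem_of_mem_star hsub h0 (hIJ.ray_mem hmem) hI hstar
    obtain ⟨a, b, ha, hb, rfl⟩ := PointedCone.mem_hull_pair.1 hy
    have hb0 : 0 < b := by
      refine lt_of_le_of_ne hb ?_
      rintro rfl
      refine hys (Submodule.mem_span_singleton.2 ⟨a, ?_⟩)
      rw [zero_smul, add_zero]
    have hsum : TropicalM0.splitVector 6 I +
        (a • TropicalM0.splitVector 6 I + b • TropicalM0.splitVector 6 J) =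
        (1 + a) • TropicalM0.splitVector 6 I + b • TropicalM0.splitVector 6 J := by module
    rw [hsum] at hyY
    exact TropicalCycle.hull_pair_subset_support hsub h0 hIJ.notMem_span hmem
      (add_pos_of_pos_of_nonneg one_pos ha) hb0 hyY hx
  have hP : ∀ I J, TropicalM0.Adjacent I J → TropicalM0.cone₂ I J ∈ D.cones →
      TropicalM0.splitVector 6 I ∈ Y.support → TropicalM0.splitVector 6 J ∈ Y.support :=
    fun I J hIJ hmem hI => hfill I J hIJ hmem hI _ (PointedCone.subset_hull (by simp))
  have hsat := hD.isSaturated (fun v => v ∈ Y.support) hP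
  -- Adjacency is symmetric, so lying outside $|Y|$ propagates along cones of `D` as well.
  have hsat' := hD.isSaturated (fun v => v ∉ Y.support) fun I J hIJ hmem hI hJ =>
    hI (hP J I hIJ.symm (TropicalM0.cone₂_comm I J ▸ hmem) hJ)
  have hpair : ∀ {I J}, TropicalM0.Adjacent I J → TropicalM0.cone₂ I J ∈ D.cones →
      ∃ i j, i ≠ j ∧ TropicalM0.ray {i, j} ∈ D.cones ∧
        ∃ K, TropicalM0.Adjacent {i, j} K ∧
          TropicalM0.cone₂ {i, j} K = TropicalM0.cone₂ I J := by
    intro I J hIJ hmem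
    obtain ⟨i, j, hij, hs⟩ := hIJ.exists_pair
    have key : ∀ {A B : Finset (Fin 6)}, TropicalM0.Adjacent A B →
        TropicalM0.cone₂ A B ∈ D.cones → TropicalM0.SameSplit A {i, j} →
        TropicalM0.ray {i, j} ∈ D.cones ∧ TropicalM0.Adjacent {i, j} B ∧
          TropicalM0.cone₂ {i, j} B = TropicalM0.cone₂ A B := by
      intro A B hAB hmem hA
      have hadj : TropicalM0.Adjacent {i, j} B :=
        ⟨TropicalM0.isSplit_pair hij, hAB.right,
          (hAB.symm.compatible.congr_right hA).symm, fun h => hAB.ne (hA.trans h)⟩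
      have heq : TropicalM0.cone₂ {i, j} B = TropicalM0.cone₂ A B := by
        rw [TropicalM0.cone₂, TropicalM0.cone₂, hA.splitVector_eq]
      exact ⟨hadj.ray_mem (heq ▸ hmem), hadj, heq⟩
    rcases hs with hs | hs
    · obtain ⟨h1, h2, h3⟩ := key hIJ hmem hs
      exact ⟨i, j, hij, h1, J, h2, h3⟩
    · obtain ⟨h1, h2, h3⟩ := key hIJ.symm (TropicalM0.cone₂_comm I J ▸ hmem) hs
      exact ⟨i, j, hij, h1, I, h2, h3.trans (TropicalM0.cone₂_comm J I)⟩
  have hcone : ∀ σ ∈ D.cones, coneDim σ = 2 →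
      ∃ I J, TropicalM0.Adjacent I J ∧ σ = TropicalM0.cone₂ I J := fun σ hσ hdim =>
    TropicalM0.exists_adjacent_of_coneDim (hD.2 σ hσ) hdim
  obtain ⟨i, j, hij, hray, hijY⟩ : ∃ i j : Fin 6, i ≠ j ∧ TropicalM0.ray {i, j} ∈ D.cones ∧
      TropicalM0.splitVector 6 {i, j} ∈ Y.support := by
    obtain ⟨p, q, hp, hq, hσ, a, b, ha, hb, hab⟩ :=
      TropicalCycle.exists_mem_interior hsub fun σ hσ hdim => by
        obtain ⟨I, J, hIJ, rfl⟩ := hcone σ hσ hdim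
        exact ⟨_, _, hIJ.left.splitVector_ne_zero, hIJ.notMem_span, rfl⟩
    obtain ⟨I, J, hIJ, heq⟩ := hcone _ hσ (coneDim_hull_pair hp hq)
    obtain ⟨i, j, hij, hray, K, -, hK⟩ := hpair hIJ (heq ▸ hσ)
    refine ⟨i, j, hij, hray,
      TropicalCycle.hull_pair_subset_support hsub hp hq hσ ha hb hab ?_⟩
    rw [heq, ← hK]
    exact PointedCone.subset_hull (by simp)
  -- A pair ray outside $|Y|$ would give the second graph an edge, hence an edge common to both,
  -- although the graphs are disjoint.
  have hall : ∀ k l : Fin 6, k ≠ l → TropicalM0.ray {k, l} ∈ D.cones →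
      TropicalM0.splitVector 6 {k, l} ∈ Y.support := by
    intro k l hkl hray'
    by_contra hnot
    obtain ⟨a, b, -, h1, h2⟩ :=
      hsat.exists_common_edge hsat' hij ⟨hij, hray, hijY⟩ hkl ⟨hkl, hray', hnot⟩
    exact h2.2.2 h1.2.2
  -- Every maximal cone of `D` has a pair ray, which lies in $|Y|$, so the cone does too.
  refine hYD.2 fun x hx => ?_
  obtain ⟨σ, hσ, hxσ, hdim⟩ := PureFan.exists_maximal_cone hx
  obtain ⟨I, J, hIJ, rfl⟩ := hcone σ hσ hdim
  obtain ⟨k, l, hkl, hray', K, hK, heq⟩ := hpair hIJ hσ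
  exact hfill _ K hK (heq ▸ hσ) (hall k l hkl hray') x (heq ▸ hxσ)
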